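/- Let $n\ge 2$. Let $CB_n$ be the circular braid group, that is, the fundamental group of the configuration space of $n$ distinct unordered points in the plane less the origin $\mathbb{C}\setminus\{0\}$ (topologically an annulus), based at the configuration of the $n$ vertices $e^{2\pi i k/n}$ ($0\le k<n$) of a regular $n$-gon. Let $\zeta\in CB_n$ be the cyclic shift: the class of the loop of configurations $t\mapsto\{e^{2\pi i (k+t)/n} : 0\le k<n\}$, $t\in[0,1]$. A necklace is an oriented link $\mathcal{L}_n=K_0\cup K_1\cup\dots\cup K_n$ in $\mathbb{R}^3$ made of Euclidean circles such that (i) $K_0$ has center the origin $O$ and radius $1$; (ii) for each $i\ge1$, the circle $K_i$ has its center $O_i$ on $K_0$ and a radius $r_i$ with $0<r_i<\frac12$, and it lies in the plane that contains the line $(OO_i)$ and is perpendicular to the plane of $K_0$; (iii) if $i\ne j$ and $O_i=O_j$, then $r_i\neq r_j$; (iv) the orientations are such that $\operatorname{lk}(K_0,K_i)=+1$ for $i=1,\dots,n$. Let $\operatorname{Conf}\mathcal{L}_n$ be the space of all necklaces, the components $K_1,\dots,K_n$ being unlabelled, with the natural topology: the quotient, by the permutations of $K_1,\dots,K_n$,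 of the space of necklaces with labelled components, which is topologized by the centers, radii and oriented unit normals of the circles. Then the subgroup $\langle\zeta^{2n}\rangle$ of $CB_n$ generated by $\zeta^{2n}$ is normal and, for every base point in $\operatorname{Conf}\mathcal{L}_n$, $$\pi_1(\operatorname{Conf}\mathcal{L}_n)\;\cong\; CB_n/\langle \zeta^{2n}\rangle .$$ -/

import Mathlib

noncomputable section

/-! ### Configurations of points in the punctured plane -/

namespace CircularBraid

/-- The plane less the origin (topologically an annulus). -/
abbrev PuncturedPlane : Type := {z : ℂ // z ≠ 0}

/-- Ordered configurations of `n` distinct points in the punctured plane. -/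
def OrdConf (n : ℕ) : Type := {f : Fin n → PuncturedPlane // Function.Injective f}

instance (n : ℕ) : TopologicalSpace (OrdConf n) :=
  inferInstanceAs (TopologicalSpace {f : Fin n → PuncturedPlane // Function.Injective f})

/-- Permutations relabel the points of an ordered configuration. -/
instance (n : ℕ) : MulAction (Equiv.Perm (Fin n)) (OrdConf n) where
  smul σ f := ⟨fun i => f.1 (σ⁻¹ i), f.2.comp (σ⁻¹).injective⟩
  one_smul _ := rfl
  mul_smul _ _ _ := rfl

/-- The configuration space of `n` distinct unordered points in the punctured plane, with the
quotient topology. -/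
def Conf (n : ℕ) : Type := MulAction.orbitRel.Quotient (Equiv.Perm (Fin n)) (OrdConf n)

instance (n : ℕ) : TopologicalSpace (Conf n) :=
  inferInstanceAs (TopologicalSpace (Quotient (MulAction.orbitRel (Equiv.Perm (Fin n)) (OrdConf n))))

/-- The unordered configuration underlying an ordered one. -/
def Conf.mk {n : ℕ} (f : OrdConf n) : Conf n :=
  Quotient.mk (MulAction.orbitRel (Equiv.Perm (Fin n)) (OrdConf n)) f

theorem exp_injective (n : ℕ) (t : ℝ) : Function.Injective
    (fun k : Fin n => Complex.exp (2 * Real.pi * Complex.I * (((k : ℕ) : ℂ) + t) / n)) := by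
  intro j k h
  have hn : (n : ℂ) ≠ 0 := by
    have := j.pos
    exact_mod_cast this.ne'
  obtain ⟨m, hm⟩ := Complex.exp_eq_exp_iff_exists_int.1 h
  have hp : (2 * Real.pi * Complex.I : ℂ) ≠ 0 := Complex.two_pi_I_ne_zero
  have h1 : ((j : ℕ) : ℂ) = ((k : ℕ) : ℂ) + m * n := by
    field_simp at hm
    have h2 : (2 * Real.pi * Complex.I : ℂ) * (j : ℕ)
        = (2 * Real.pi * Complex.I : ℂ) * ((k : ℕ) + m * n) := by
      linear_combination (2 * Real.pi * Complex.I : ℂ) * hm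
    exact mul_left_cancel₀ hp h2
  have h3 : ((j : ℕ) : ℤ) = ((k : ℕ) : ℤ) + m * n := by exact_mod_cast h1
  have h4 : ((j : ℕ) : ℤ) % n = ((k : ℕ) : ℤ) % n := by rw [h3]; simp
  rw [Int.emod_eq_of_lt (by positivity) (by exact_mod_cast j.2),
    Int.emod_eq_of_lt (by positivity) (by exact_mod_cast k.2)] at h4
  exact Fin.ext (by exact_mod_cast h4)

/-- The vertices `exp (2πi (k + t) / n)`, `k = 0, …, n - 1`, of a regular `n`-gon: the standard one
turned by `t / n` of a full turn. -/
def polygon (n : ℕ) (t : ℝ) : OrdConf n :=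
  ⟨fun k => ⟨Complex.exp (2 * Real.pi * Complex.I * (((k : ℕ) : ℂ) + t) / n),
    Complex.exp_ne_zero _⟩, fun _ _ h => exp_injective n t (congrArg Subtype.val h)⟩

/-- The base configuration: the vertices of the standard regular `n`-gon. -/
def basePoint (n : ℕ) : Conf n := Conf.mk (polygon n 0)

theorem mk_polygon_one (n : ℕ) : Conf.mk (polygon n 1) = basePoint n := by
  refine Quotient.sound (s := MulAction.orbitRel (Equiv.Perm (Fin n)) (OrdConf n))
    ⟨(finRotate n)⁻¹, Subtype.ext (funext fun k => Subtype.ext ?_)⟩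
  obtain _ | m := n
  · exact k.elim0
  change Complex.exp (2 * Real.pi * Complex.I * (((finRotate (m + 1) k : ℕ) : ℂ) + (0 : ℝ))
    / (m + 1 : ℕ)) = Complex.exp (2 * Real.pi * Complex.I * (((k : ℕ) : ℂ) + (1 : ℝ)) / (m + 1 : ℕ))
  rw [coe_finRotate]
  split_ifs with h
  · subst h
    have hm : ((m : ℂ) + 1) ≠ 0 := by exact_mod_cast Nat.succ_ne_zero m
    simp [mul_div_assoc, div_self hm]
  · simp

/-- The cyclic shift of the `n` points: the polygon turns through the angle `2π / n`, so that each
vertex moves to the next one. -/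
def shiftLoop (n : ℕ) : Path (basePoint n) (basePoint n) where
  toFun t := Conf.mk (polygon n t)
  continuous_toFun := by
    refine continuous_quotient_mk'.comp (Continuous.subtype_mk (continuous_pi fun k =>
      Continuous.subtype_mk ?_ _) _)
    fun_prop
  source' := rfl
  target' := mk_polygon_one n

end CircularBraid

/-- The circular braid group: the fundamental group of the configuration space of `n` distinct
points in the plane less the origin. -/
abbrev CB (n : ℕ) : Type := FundamentalGroup (CircularBraid.Conf n) (CircularBraid.basePoint n)

/-- The cyclic-shift generator `ζ` of the circular braid group. -/
def CB.zeta (n : ℕ) : CB n :=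
  FundamentalGroup.fromPath (Path.Homotopic.Quotient.mk (CircularBraid.shiftLoop n))

/-! ### Necklaces -/

/-- Euclidean three-space; its origin is the point `O`. -/
abbrev Space3 : Type := EuclideanSpace ℝ (Fin 3)

/-- An oriented Euclidean circle in three-space, given by its centre, its radius and the unit normal
of its plane that determines its orientation by the right-hand rule. These data and the oriented
circle determine each other. -/
structure OrientedCircle where
  center : Space3
  radius : ℝ
  normal : Space3
  radius_pos : 0 < radius
  norm_normal : ‖normal‖ = 1

namespace OrientedCircle

/-- The plane that contains the circle. -/
def plane (K : OrientedCircle) : Set Space3 := {x | inner ℝ (x - K.center) K.normal = 0}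

/-- The points of the circle. -/
def carrier (K : OrientedCircle) : Set Space3 := {x ∈ K.plane | dist x K.center = K.radius}

/-- Circles are close when their centres, radii and oriented normals are. -/
instance : TopologicalSpace OrientedCircle :=
  TopologicalSpace.induced (fun K => (K.center, K.radius, K.normal)) inferInstance

end OrientedCircle

/-- The vector product of three-space. -/
def cross3 (v w : Space3) : Space3 := WithLp.toLp 2 (crossProduct (WithLp.ofLp v) (WithLp.ofLp w))

/-- The circles `K₀` (the core) and `K 0, …, K (n - 1)` are the components of a necklace. -/
structure IsNecklace {n : ℕ} (K₀ : OrientedCircle) (K : Fin n → OrientedCircle) : Prop where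
  /-- The core is centred at `O` and has radius `1`. -/
  core_center : K₀.center = 0
  core_radius : K₀.radius = 1
  center_mem : ∀ i, (K i).center ∈ K₀.carrier
  radius_lt : ∀ i, (K i).radius < 1 / 2
  /-- The plane of `K i` contains the line through `O` and the centre of `K i`. -/
  line_subset : ∀ i, (line[ℝ, (0 : Space3), (K i).center] : Set Space3) ⊆ (K i).plane
  /-- The plane of `K i` is perpendicular to the plane of the core. -/
  perp : ∀ i, inner ℝ K₀.normal (K i).normal = 0
  /-- The linking number of `K₀` and `K i` is `+1`: the core meets the flat disc bounded by `K i`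
  exactly once, in the centre of `K i`, where its direction is the vector product below, and
  it has to cross the disc in the direction of the positive normal. -/
  linking : ∀ i, 0 < inner ℝ (cross3 K₀.normal (K i).center) (K i).normal
  radius_ne : ∀ i j, i ≠ j → (K i).center = (K j).center → (K i).radius ≠ (K j).radius

namespace Necklace

/-- Necklaces with `n` labelled components besides the core. -/
def OrdConf (n : ℕ) : Type :=
  {p : OrientedCircle × (Fin n → OrientedCircle) // IsNecklace p.1 p.2}

instance (n : ℕ) : TopologicalSpace (OrdConf n) :=
  inferInstanceAs
    (TopologicalSpace {p : OrientedCircle × (Fin n → OrientedCircle) // IsNecklace p.1 p.2})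

theorem isNecklace_perm {n : ℕ} {K₀ : OrientedCircle} {K : Fin n → OrientedCircle}
    (h : IsNecklace K₀ K) (σ : Equiv.Perm (Fin n)) : IsNecklace K₀ (fun i => K (σ i)) where
  core_center := h.core_center
  core_radius := h.core_radius
  center_mem i := h.center_mem (σ i)
  radius_lt i := h.radius_lt (σ i)
  line_subset i := h.line_subset (σ i)
  perp i := h.perp (σ i)
  linking i := h.linking (σ i)
  radius_ne i j hij := h.radius_ne (σ i) (σ j) (σ.injective.ne hij)

/-- Permutations relabel the components other than the core. -/
instance (n : ℕ) : MulAction (Equiv.Perm (Fin n)) (OrdConf n) where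
  smul σ p := ⟨(p.1.1, fun i => p.1.2 (σ⁻¹ i)), isNecklace_perm p.2 σ⁻¹⟩
  one_smul _ := rfl
  mul_smul _ _ _ := rfl

/-- The configuration space of necklaces: a necklace is a link, so its components
`K₁, …, Kₙ` are not labelled. -/
def Conf (n : ℕ) : Type := MulAction.orbitRel.Quotient (Equiv.Perm (Fin n)) (OrdConf n)

instance (n : ℕ) : TopologicalSpace (Conf n) :=
  inferInstanceAs (TopologicalSpace (Quotient (MulAction.orbitRel (Equiv.Perm (Fin n)) (OrdConf n))))

end Necklace

end

/-! A necklace has an oriented unit normal of its core, so the space of necklaces maps to the sphere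
$S^2$. The fibre over the third axis is the configuration space of the punctured plane: the argument
of a point fixes where the bead sits on the core and its modulus fixes the radius, so equal beads
are equal points (`Conf.isEmbedding_necklace`, `IsNecklace.ofBead_spec`). The unit quaternions act
on everything by rotations, and the stabilizer of the axis is the circle `axial θ`, which turns the
fibre through the angle $2\theta$.

The theorem is the exact sequence $\pi_2(S^2)\to CB_n\to\pi_1(\operatorname{Conf}\mathcal
L_n)\to\pi_1(S^2)=1$ of this fibration. The Hopf map $S^3\to S^2$ identifies $\pi_2(S^2)$ with the
fundamental group of the axial circle. Its generator $0\le\theta\le2\pi$ turns configurations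
through $4\pi$; since $\zeta$ turns the polygon through $2\pi/n$, its image is generated by
$\zeta^{2n}$.

No exact sequence is invoked. Homotopies of unit vectors are lifted to unit quaternions
(`exists_lift_homotopy`), and undoing the lifted rotation moves families of necklaces into the
fibre. With the simple connectedness of $S^3$ this gives surjectivity (`necklaceHom_surjective`) and
kills $\zeta^{2n}$ (`necklaceHom_zeta_pow`). Straightening a null homotopy leaves one side of a
square, a loop of polygons, which bounds the kernel (`mem_zpowers_of_necklaceHom_eq_one`). -/

noncomputable section

open Metric Set unitInterval
open scoped Quaternion

/-! ### Paths and homotopies -/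

section Square

variable {Y : Type*} [TopologicalSpace Y]

/-- A square whose left and top sides are constant gives a relation between its other two sides. -/
theorem Path.Homotopic.trans_refl_of_square {y : Y} (φ : C(I × I, Y)) (hleft : ∀ s, φ (s, 0) = y)
    (htop : ∀ t, φ (1, t) = y) (γ δ : Path y y) (hγ : ∀ t, φ (0, t) = γ t)
    (hδ : ∀ s, φ (s, 1) = δ s) : (γ.trans δ).Homotopic (Path.refl y) := by
  -- Clamping the coordinates extends the square to the plane, which is simply connected, so the two
  -- ways around the boundary become homotopic.
  let ψ : C(ℝ × ℝ, Y) := ⟨fun z => φ (projIcc 0 1 zero_le_one z.1, projIcc 0 1 zero_le_one z.2),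
    φ.continuous.comp ((continuous_projIcc.comp continuous_fst).prodMk
      (continuous_projIcc.comp continuous_snd))⟩
  let b : Path ((0, 0) : ℝ × ℝ) (0, 1) := ⟨⟨fun t => (0, t), by fun_prop⟩, rfl, rfl⟩
  let r : Path ((0, 1) : ℝ × ℝ) (1, 1) := ⟨⟨fun s => (s, 1), by fun_prop⟩, rfl, rfl⟩
  let l : Path ((0, 0) : ℝ × ℝ) (1, 0) := ⟨⟨fun s => (s, 0), by fun_prop⟩, rfl, rfl⟩
  let u : Path ((1, 0) : ℝ × ℝ) (1, 1) := ⟨⟨fun t => (1, t), by fun_prop⟩, rfl, rfl⟩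
  have hψ0 : ψ (0, 0) = y := by simpa [ψ] using hleft 0
  have hψ1 : ψ (1, 1) = y := by simpa [ψ] using htop 1
  have h := ((SimplyConnectedSpace.paths_homotopic (b.trans r) (l.trans u)).map ψ)
  have h2 := h.pathCast (x₂ := y) (x₃ := y) hψ0.symm hψ1.symm
  have e1 : ((b.trans r).map ψ.continuous).cast hψ0.symm hψ1.symm = γ.trans δ := by
    ext t
    simp only [Path.cast_coe, Path.map_coe, Function.comp_apply, Path.trans_apply]
    split_ifs
    · simpa [ψ, b, projIcc_of_mem _ (mul_pos_mem_iff zero_lt_two |>.2 ⟨t.2.1, by assumption⟩)]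
        using hγ _
    · simpa [ψ, r, projIcc_of_mem _ (two_mul_sub_one_mem_iff.2 ⟨(not_le.1 (by assumption)).le,
        t.2.2⟩)] using hδ _
  have e2 : ((l.trans u).map ψ.continuous).cast hψ0.symm hψ1.symm = Path.refl y := by
    ext t
    simp only [Path.cast_coe, Path.map_coe, Function.comp_apply, Path.trans_apply]
    split_ifs
    · simpa [ψ, l] using hleft _
    · simpa [ψ, u] using htop _
  rwa [e1, e2] at h2

end Square

/-! ### Spheres are simply connected -/

section Sphere

variable {E : Type*} [NormedAddCommGroup E] [InnerProductSpace ℝ E]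

/-- The sphere minus a point is simply connected. -/
theorem isSimplyConnected_sphere_compl_singleton (v : sphere (0 : E) 1) :
    IsSimplyConnected ({v}ᶜ : Set (sphere (0 : E) 1)) := by
  let e := (stereographic (norm_eq_of_mem_sphere v)).toHomeomorphSourceTarget
  have : ContractibleSpace (stereographic (norm_eq_of_mem_sphere v)).target := by
    rw [stereographic_target]
    exact (Homeomorph.Set.univ _).contractibleSpace_iff.2 inferInstance
  exact e.toHomotopyEquiv.simplyConnectedSpace

/-- A loop in the sphere is homotopic to one that misses a point. -/
theorem exists_homotopic_loop_avoiding [FiniteDimensional ℝ E] (hE : 2 < Module.finrank ℝ E)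
    {x : sphere (0 : E) 1} (γ : Path x x) :
    ∃ (δ : Path x x) (v : sphere (0 : E) 1), γ.Homotopic δ ∧ ∀ t, δ t ≠ v := by
  -- A $C^1$ approximation with error below $1/4$. The affine correction in `q` restores both
  -- endpoints and costs at most another $1/4$, so `q` stays within distance $1$ of `γ`.
  obtain ⟨g, hg, hgγ, -⟩ := (continuous_subtype_val.comp
    (γ.continuous_extend)).exists_contDiff_approx (F := E) 1 (ε := fun _ => 1 / 4)
      continuous_const (fun _ => by norm_num)
  let q : ℝ → E := fun t => g t + ((1 - t) • ((x : E) - g 0) + t • ((x : E) - g 1))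
  have hq : ContDiff ℝ 1 q := by fun_prop
  have hq0 : q 0 = x := by simp [q]
  have hq1 : q 1 = x := by simp [q]
  have hdist : ∀ t : I, ‖q t - γ t‖ < 1 := by
    intro t
    have h1 := hgγ t
    have h2 := hgγ 0
    have h3 := hgγ 1
    simp only [dist_eq_norm, Function.comp_apply, Path.extend_zero, Path.extend_one,
      Path.extend_apply γ t.2] at h1 h2 h3
    rw [norm_sub_rev] at h2 h3
    have e : q t - γ t = (g t - γ t)
        + ((1 - (t : ℝ)) • ((x : E) - g 0) + (t : ℝ) • ((x : E) - g 1)) := by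
      simp only [q]; abel
    rw [e]
    calc _ ≤ ‖g t - γ t‖ + (‖(1 - (t : ℝ)) • ((x : E) - g 0)‖ + ‖(t : ℝ) • ((x : E) - g 1)‖) :=
          (norm_add_le _ _).trans (add_le_add_right (norm_add_le _ _) _)
      _ ≤ ‖g t - γ t‖ + ((1 - t) * (1 / 4) + t * (1 / 4)) := by
          rw [norm_smul, norm_smul, Real.norm_of_nonneg t.2.1,
            Real.norm_of_nonneg (sub_nonneg.2 t.2.2)]
          have := t.2.1
          have := sub_nonneg.2 t.2.2
          gcongr
      _ < 1 := by linarith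
  -- The segment from a unit vector to a point at distance less than $1$ misses the origin, so it
  -- can be normalized; this is the homotopy from `γ` to `δ`.
  have hne : ∀ s t : I, (1 - (s : ℝ)) • (γ t : E) + (s : ℝ) • q t ≠ 0 := by
    intro s t h
    have e : (γ t : E) = - ((s : ℝ) • (q t - γ t)) := by
      have e' : (γ t : E) + (s : ℝ) • (q t - γ t) = (1 - (s : ℝ)) • (γ t : E) + (s : ℝ) • q t := by
        module
      exact eq_neg_of_add_eq_zero_left (e'.trans h)
    have h1 : ‖(γ t : E)‖ = 1 := norm_eq_of_mem_sphere _
    rw [e, norm_neg, norm_smul, Real.norm_of_nonneg s.2.1] at h1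
    have := mul_le_mul_of_nonneg_right s.2.2 (norm_nonneg (q t - γ t))
    linarith [hdist t]
  have hnorm : ∀ w : E, w ≠ 0 → ‖w‖⁻¹ • w ∈ sphere (0 : E) 1 := fun w hw => by
    simp [norm_smul, hw]
  have hqne : ∀ t : I, q t ≠ 0 := fun t => by simpa using hne 1 t
  let δ : Path x x :=
    { toFun := fun t => ⟨_, hnorm _ (hqne t)⟩
      continuous_toFun := by
        refine Continuous.subtype_mk (Continuous.smul (Continuous.inv₀ ?_ ?_) ?_) _
        · have := hq.continuous; fun_prop
        · exact fun t => norm_ne_zero_iff.2 (hqne t)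
        · have := hq.continuous; fun_prop
      source' := by ext; simp [hq0]
      target' := by ext; simp [hq1] }
  have hγδ : γ.Homotopic δ := by
    refine ⟨⟨⟨⟨fun z => ⟨_, hnorm _ (hne z.1 z.2)⟩, ?_⟩, ?_, ?_⟩, ?_⟩⟩
    · refine Continuous.subtype_mk (Continuous.smul (Continuous.inv₀ ?_ ?_) ?_) _
      · have := hq.continuous; fun_prop
      · exact fun z => norm_ne_zero_iff.2 (hne z.1 z.2)
      · have := hq.continuous; fun_prop
    · intro t; ext; simp
    · intro t; ext; simp [δ]
    · rintro s t (rfl | rfl)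
      · ext; simp [hq0, ← add_smul]
      · ext; simp [hq1, ← add_smul]
  -- The cone over the curve `q` is a $C^1$ image of a plane in dimension greater than $2$. A vector
  -- outside it has a direction that `δ` never takes.
  have hd : Dense (range fun z : ℝ × ℝ => z.1 • q z.2)ᶜ :=
    ContDiff.dense_compl_range_of_finrank_lt_finrank (by fun_prop) (by simpa using hE)
  have : Nonempty E := ⟨0⟩
  obtain ⟨w, hw⟩ := hd.nonempty
  have hw0 : w ≠ 0 := by
    rintro rfl
    exact hw ⟨(0, 0), by simp⟩
  refine ⟨δ, ⟨_, hnorm w hw0⟩, hγδ, fun t ht => hw ⟨(‖w‖ * ‖q t‖⁻¹, t), ?_⟩⟩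
  have := congrArg Subtype.val ht
  change ‖q t‖⁻¹ • q t = ‖w‖⁻¹ • w at this
  change (‖w‖ * ‖q t‖⁻¹) • q t = w
  rw [mul_smul, this, smul_smul, mul_inv_cancel₀ (norm_ne_zero_iff.2 hw0), one_smul]

/-- A loop can be pushed off some point, and stereographic projection from that point makes the rest
of the sphere contractible. -/
theorem simplyConnectedSpace_sphere [FiniteDimensional ℝ E] (hE : 2 < Module.finrank ℝ E) :
    SimplyConnectedSpace (sphere (0 : E) 1) := by
  rw [simply_connected_iff_loops_nullhomotopic]
  refine ⟨isPathConnected_iff_pathConnectedSpace.1 (isPathConnected_sphere ?_ _ zero_le_one),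
    fun x γ => ?_⟩
  · rw [← Module.finrank_eq_rank]
    exact_mod_cast (by omega : 1 < Module.finrank ℝ E)
  · obtain ⟨δ, v, hγδ, hδ⟩ := exists_homotopic_loop_avoiding hE γ
    obtain ⟨F, -⟩ := (isSimplyConnected_iff_exists_homotopy_refl_forall_mem.1
      (isSimplyConnected_sphere_compl_singleton v)).2 x δ hδ
    exact hγδ.trans ⟨F⟩

end Sphere
end

noncomputable section

open Metric Set unitInterval
open scoped Quaternion

/-! ### Rotations of three-space by unit quaternions -/

/-- The group of unit quaternions. -/
abbrev UnitQuaternion : Type := sphere (0 : ℍ[ℝ]) 1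

namespace Space3

theorem inner_eq (v w : Space3) : inner ℝ v w = v 0 * w 0 + v 1 * w 1 + v 2 * w 2 := by
  simp [PiLp.inner_apply, Fin.sum_univ_three]
  ring

theorem ext' {v w : Space3} (h0 : v 0 = w 0) (h1 : v 1 = w 1) (h2 : v 2 = w 2) : v = w := by
  ext i; fin_cases i <;> assumption

/-- The quaternion with the given coordinates. -/
def quaternion (a b c d : ℝ) : ℍ[ℝ] := ⟨a, b, c, d⟩

@[simp] theorem quaternion_re (a b c d : ℝ) : (quaternion a b c d).re = a := rfl
@[simp] theorem quaternion_imI (a b c d : ℝ) : (quaternion a b c d).imI = b := rfl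
@[simp] theorem quaternion_imJ (a b c d : ℝ) : (quaternion a b c d).imJ = c := rfl
@[simp] theorem quaternion_imK (a b c d : ℝ) : (quaternion a b c d).imK = d := rfl

@[fun_prop]
theorem continuous_quaternion {Z : Type*} [TopologicalSpace Z] {a b c d : Z → ℝ}
    (ha : Continuous a) (hb : Continuous b) (hc : Continuous c) (hd : Continuous d) :
    Continuous fun z => quaternion (a z) (b z) (c z) (d z) := by
  have h : (fun z => quaternion (a z) (b z) (c z) (d z)) =
      fun z => Quaternion.linearIsometryEquivTuple.symm !₂[a z, b z, c z, d z] := by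
    ext z <;> rfl
  rw [h]
  fun_prop

theorem quaternion_mem_sphere {a b c d : ℝ} (h : a ^ 2 + b ^ 2 + c ^ 2 + d ^ 2 = 1) :
    quaternion a b c d ∈ sphere (0 : ℍ[ℝ]) 1 := by
  rw [mem_sphere_zero_iff_norm, ← pow_eq_one_iff_of_nonneg (norm_nonneg _) two_ne_zero, sq,
    ← Quaternion.normSq_eq_norm_mul_self, Quaternion.normSq_def']
  simpa using h

/-- The imaginary quaternion with the coordinates of a vector. -/
def toQuaternion (v : Space3) : ℍ[ℝ] := quaternion 0 (v 0) (v 1) (v 2)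

/-- The imaginary part of a quaternion. -/
def ofQuaternion (q : ℍ[ℝ]) : Space3 := !₂[q.imI, q.imJ, q.imK]

theorem ofQuaternion_toQuaternion (v : Space3) : ofQuaternion (toQuaternion v) = v :=
  ext' rfl rfl rfl

@[fun_prop]
theorem continuous_toQuaternion : Continuous toQuaternion := by
  unfold toQuaternion
  fun_prop

@[fun_prop]
theorem continuous_ofQuaternion : Continuous ofQuaternion := by
  unfold ofQuaternion
  have := Quaternion.continuous_imI
  have := Quaternion.continuous_imJ
  have := Quaternion.continuous_imK
  fun_prop

/-- The rotation `v ↦ q v q⁻¹`. -/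
def rotate (q : UnitQuaternion) (v : Space3) : Space3 :=
  ofQuaternion (q * toQuaternion v * star (q : ℍ[ℝ]))

theorem normSq_coe (q : UnitQuaternion) :
    (q : ℍ[ℝ]).re ^ 2 + (q : ℍ[ℝ]).imI ^ 2 + (q : ℍ[ℝ]).imJ ^ 2 + (q : ℍ[ℝ]).imK ^ 2 = 1 := by
  have h := Quaternion.normSq_eq_norm_mul_self (q : ℍ[ℝ])
  rw [norm_eq_of_mem_sphere, Quaternion.normSq_def'] at h
  linarith

theorem toQuaternion_rotate (q : UnitQuaternion) (v : Space3) :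
    toQuaternion (rotate q v) = q * toQuaternion v * star (q : ℍ[ℝ]) := by
  ext <;> simp [toQuaternion, rotate, ofQuaternion]
  ring

@[fun_prop]
theorem continuous_rotate {Z : Type*} [TopologicalSpace Z] {q : Z → UnitQuaternion} {v : Z → Space3}
    (hq : Continuous q) (hv : Continuous v) : Continuous fun z => rotate (q z) (v z) := by
  unfold rotate
  fun_prop

theorem rotate_one (v : Space3) : rotate 1 v = v := by
  simp [rotate, ofQuaternion_toQuaternion]

theorem rotate_mul (p q : UnitQuaternion) (v : Space3) :
    rotate (p * q) v = rotate p (rotate q v) := by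
  rw [rotate, rotate, toQuaternion_rotate]
  simp [mul_assoc]

theorem rotate_zero (q : UnitQuaternion) : rotate q 0 = 0 := by
  have : toQuaternion 0 = 0 := by ext <;> rfl
  simp only [rotate, this]
  simp
  exact ext' rfl rfl rfl

theorem rotate_coord_zero (q : UnitQuaternion) (v : Space3) : rotate q v 0 =
    ((q : ℍ[ℝ]).re ^ 2 + (q : ℍ[ℝ]).imI ^ 2 - (q : ℍ[ℝ]).imJ ^ 2 - (q : ℍ[ℝ]).imK ^ 2) * v 0
    + 2 * ((q : ℍ[ℝ]).imI * (q : ℍ[ℝ]).imJ - (q : ℍ[ℝ]).re * (q : ℍ[ℝ]).imK) * v 1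
    + 2 * ((q : ℍ[ℝ]).imI * (q : ℍ[ℝ]).imK + (q : ℍ[ℝ]).re * (q : ℍ[ℝ]).imJ) * v 2 := by
  simp [rotate, ofQuaternion, toQuaternion]
  ring

theorem rotate_coord_one (q : UnitQuaternion) (v : Space3) : rotate q v 1 =
    2 * ((q : ℍ[ℝ]).imI * (q : ℍ[ℝ]).imJ + (q : ℍ[ℝ]).re * (q : ℍ[ℝ]).imK) * v 0
    + ((q : ℍ[ℝ]).re ^ 2 - (q : ℍ[ℝ]).imI ^ 2 + (q : ℍ[ℝ]).imJ ^ 2 - (q : ℍ[ℝ]).imK ^ 2) * v 1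
    + 2 * ((q : ℍ[ℝ]).imJ * (q : ℍ[ℝ]).imK - (q : ℍ[ℝ]).re * (q : ℍ[ℝ]).imI) * v 2 := by
  simp [rotate, ofQuaternion, toQuaternion]
  ring

theorem rotate_coord_two (q : UnitQuaternion) (v : Space3) : rotate q v 2 =
    2 * ((q : ℍ[ℝ]).imI * (q : ℍ[ℝ]).imK - (q : ℍ[ℝ]).re * (q : ℍ[ℝ]).imJ) * v 0
    + 2 * ((q : ℍ[ℝ]).imJ * (q : ℍ[ℝ]).imK + (q : ℍ[ℝ]).re * (q : ℍ[ℝ]).imI) * v 1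
    + ((q : ℍ[ℝ]).re ^ 2 - (q : ℍ[ℝ]).imI ^ 2 - (q : ℍ[ℝ]).imJ ^ 2 + (q : ℍ[ℝ]).imK ^ 2) * v 2 := by
  simp [rotate, ofQuaternion, toQuaternion]
  ring

theorem inner_rotate_rotate (q : UnitQuaternion) (v w : Space3) :
    inner ℝ (rotate q v) (rotate q w) = inner ℝ v w := by
  -- For an arbitrary quaternion, conjugation scales inner products by $|q|^4$; this is a polynomial
  -- identity.
  have h : inner ℝ (rotate q v) (rotate q w) = ((q : ℍ[ℝ]).re ^ 2 + (q : ℍ[ℝ]).imI ^ 2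
      + (q : ℍ[ℝ]).imJ ^ 2 + (q : ℍ[ℝ]).imK ^ 2) ^ 2 * inner ℝ v w := by
    simp only [inner_eq, rotate_coord_zero, rotate_coord_one, rotate_coord_two]
    ring
  rw [h, normSq_coe, one_pow, one_mul]

theorem norm_rotate (q : UnitQuaternion) (v : Space3) : ‖rotate q v‖ = ‖v‖ := by
  rw [norm_eq_sqrt_real_inner, norm_eq_sqrt_real_inner, inner_rotate_rotate]

theorem cross3_zero (v w : Space3) : cross3 v w 0 = v 1 * w 2 - v 2 * w 1 := by
  simp [cross3, crossProduct]

theorem cross3_one (v w : Space3) : cross3 v w 1 = v 2 * w 0 - v 0 * w 2 := by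
  simp [cross3, crossProduct]

theorem cross3_two (v w : Space3) : cross3 v w 2 = v 0 * w 1 - v 1 * w 0 := by
  simp [cross3, crossProduct]

/-- As polynomials the two sides differ by the factor $|q|^2$, which is $1$ here. -/
theorem cross3_rotate_rotate (q : UnitQuaternion) (v w : Space3) :
    cross3 (rotate q v) (rotate q w) = rotate q (cross3 v w) := by
  have h := normSq_coe q
  apply ext' <;>
    simp only [cross3_zero, cross3_one, cross3_two, rotate_coord_zero, rotate_coord_one,
      rotate_coord_two]
  · rw [← sub_eq_zero]
    trans ((q : ℍ[ℝ]).re ^ 2 + (q : ℍ[ℝ]).imI ^ 2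
      + (q : ℍ[ℝ]).imJ ^ 2 + (q : ℍ[ℝ]).imK ^ 2 - 1) * rotate q (cross3 v w) 0
    · simp only [cross3_zero, cross3_one, cross3_two, rotate_coord_zero]
      ring
    · rw [h]; ring
  · rw [← sub_eq_zero]
    trans ((q : ℍ[ℝ]).re ^ 2 + (q : ℍ[ℝ]).imI ^ 2
      + (q : ℍ[ℝ]).imJ ^ 2 + (q : ℍ[ℝ]).imK ^ 2 - 1) * rotate q (cross3 v w) 1
    · simp only [cross3_zero, cross3_one, cross3_two, rotate_coord_one]
      ring
    · rw [h]; ring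
  · rw [← sub_eq_zero]
    trans ((q : ℍ[ℝ]).re ^ 2 + (q : ℍ[ℝ]).imI ^ 2
      + (q : ℍ[ℝ]).imJ ^ 2 + (q : ℍ[ℝ]).imK ^ 2 - 1) * rotate q (cross3 v w) 2
    · simp only [cross3_zero, cross3_one, cross3_two, rotate_coord_two]
      ring
    · rw [h]; ring

/-! ### The shortest rotation between two unit vectors -/

/-- A positive multiple of the unit quaternion that rotates the unit vector `v` into the unit vector
`w` along the shortest great arc. -/
def arc (v w : Space3) : ℍ[ℝ] := 1 - toQuaternion w * toQuaternion v

open Classical in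
/-- The unit quaternion that rotates the unit vector `v` into the unit vector `w` along the shortest
great arc. -/
def align (v w : Space3) : UnitQuaternion :=
  if h : arc v w = 0 then 1 else ⟨‖arc v w‖⁻¹ • arc v w, by simp [norm_smul, h]⟩

theorem toQuaternion_mul_self {v : Space3} (hv : ‖v‖ = 1) :
    toQuaternion v * toQuaternion v = -1 := by
  have h : inner ℝ v v = (1 : ℝ) := by rw [real_inner_self_eq_norm_sq, hv, one_pow]
  rw [inner_eq] at h
  ext <;> simp [toQuaternion] <;> linarith

theorem arc_self {v : Space3} (hv : ‖v‖ = 1) : arc v v = ((2 : ℝ) : ℍ[ℝ]) := by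
  rw [arc, toQuaternion_mul_self hv, sub_neg_eq_add]
  ext <;> simp
  norm_num

/-- The real part is $1+\langle v,w\rangle$, which is zero only if $|v-w|=2$. -/
theorem arc_ne_zero {v w : Space3} (hv : ‖v‖ = 1) (hw : ‖w‖ = 1) (h : dist v w < 2) :
    arc v w ≠ 0 := by
  intro h0
  have h1 : (arc v w).re = 1 + inner ℝ v w := by
    simp [arc, toQuaternion, inner_eq]; ring
  have h2 := norm_sub_sq_real v w
  rw [h0, Quaternion.re_zero] at h1
  rw [dist_eq_norm] at h
  rw [hv, hw] at h2
  nlinarith [norm_nonneg (v - w)]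

theorem coe_align {v w : Space3} (h : arc v w ≠ 0) :
    (align v w : ℍ[ℝ]) = ‖arc v w‖⁻¹ • arc v w := by
  rw [align, dif_neg h]

theorem align_self {v : Space3} (hv : ‖v‖ = 1) : align v v = 1 := by
  ext : 1
  have h2 : arc v v ≠ 0 := fun h => by
    simpa [arc_self hv] using congrArg (fun q : ℍ[ℝ] => q.re) h
  rw [coe_align h2, arc_self hv, Quaternion.norm_coe]
  ext <;> simp

/-- Since $v^2=w^2=-1$, both $(1-wv)v$ and $w(1-wv)$ equal $v+w$. -/
theorem rotate_align {v w : Space3} (hv : ‖v‖ = 1) (hw : ‖w‖ = 1) (h : arc v w ≠ 0) :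
    rotate (align v w) v = w := by
  have e : arc v w * toQuaternion v = toQuaternion w * arc v w := by
    have h1 := toQuaternion_mul_self hv
    have h2 := toQuaternion_mul_self hw
    rw [arc, sub_mul, mul_sub, mul_assoc, h1, ← mul_assoc, h2]
    simp [add_comm]
  have e2 : (align v w : ℍ[ℝ]) * toQuaternion v = toQuaternion w * align v w := by
    rw [coe_align h, smul_mul_assoc, e, mul_smul_comm]
  rw [rotate, e2, mul_assoc, Quaternion.self_mul_star, Quaternion.normSq_eq_norm_mul_self,
    norm_eq_of_mem_sphere]
  simp [ofQuaternion_toQuaternion]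

theorem continuous_align {Z : Type*} [TopologicalSpace Z] {f g : Z → Space3} (hf : Continuous f)
    (hg : Continuous g) (h : ∀ z, arc (f z) (g z) ≠ 0) :
    Continuous fun z => align (f z) (g z) := by
  rw [continuous_induced_rng]
  have e : (Subtype.val ∘ fun z => align (f z) (g z))
      = fun z => ‖arc (f z) (g z)‖⁻¹ • arc (f z) (g z) := funext fun z => coe_align (h z)
  have hc : Continuous fun z => arc (f z) (g z) := by unfold arc; fun_prop
  rw [e]
  exact (hc.norm.inv₀ fun z => norm_ne_zero_iff.2 (h z)).smul hc

/-! ### Lifting homotopies of unit vectors to unit quaternions -/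

/-- A homotopy of paths of unit vectors lifts to rotations. -/
theorem exists_lift_homotopy (h : C(I × I, Space3)) (hh : ∀ z, ‖h z‖ = 1) :
    ∃ p : C(I × I, UnitQuaternion), (∀ s t, rotate (p (s, t)) (h (s, 0)) = h (s, t)) ∧
      (∀ s, p (s, 0) = 1) ∧ ∀ s, (∀ t, h (s, t) = h (s, 0)) → ∀ t, p (s, t) = 1 := by
  -- Viewing the homotopy as a path in `t` of functions of `s`, with the sup metric, gives one
  -- subdivision of the `t`-interval that serves all `s`: on each piece the vectors move by less
  -- than $2$, so are never antipodal.
  let H : C(I, C(I, Space3)) := (h.comp ContinuousMap.prodSwap).curry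
  obtain ⟨u, hu0, humono, ⟨k, hk⟩, hu⟩ := exists_monotone_Icc_subset_open_cover_unitInterval
    (c := fun f : C(I, Space3) => H ⁻¹' ball f 1) (fun f => isOpen_ball.preimage H.continuous)
    (fun t _ => mem_iUnion.2 ⟨H t, by simp⟩)
  have hdist : ∀ i s t, dist (h (s, min t (u i))) (h (s, min t (u (i + 1)))) < 2 := by
    intro i s t
    rcases le_total t (u i) with ht | ht
    · rw [min_eq_left ht, min_eq_left (ht.trans (humono i.le_succ)), dist_self]
      norm_num
    · obtain ⟨f, hf⟩ := hu i
      have h1 : dist (H (u i)) f < 1 := hf ⟨le_rfl, humono i.le_succ⟩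
      have h2 : dist (H (min t (u (i + 1)))) f < 1 :=
        hf ⟨le_min ht (humono i.le_succ), min_le_right _ _⟩
      rw [min_eq_right ht]
      calc _ ≤ dist (H (u i)) (H (min t (u (i + 1)))) :=
            ContinuousMap.dist_apply_le_dist (f := H (u i)) (g := H (min t (u (i + 1)))) s
        _ ≤ dist (H (u i)) f + dist (H (min t (u (i + 1)))) f := dist_triangle_right _ _ _
        _ < 2 := by linarith
  -- Induction over the subdivision: the time is frozen at `u i`, so each stage is already defined
  -- on the whole square.
  have key : ∀ i, ∃ p : C(I × I, UnitQuaternion),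
      (∀ s t, rotate (p (s, t)) (h (s, 0)) = h (s, min t (u i))) ∧
      (∀ s, p (s, 0) = 1) ∧ ∀ s, (∀ t, h (s, t) = h (s, 0)) → ∀ t, p (s, t) = 1 := by
    intro i
    induction i with
    | zero => exact ⟨.const _ 1, fun s t => by simp [rotate_one, hu0], fun _ => rfl,
        fun _ _ _ => rfl⟩
    | succ i ih =>
      obtain ⟨p, hp, hp0, hp1⟩ := ih
      have harc : ∀ z : I × I, arc (h (z.1, min z.2 (u i))) (h (z.1, min z.2 (u (i + 1)))) ≠ 0 :=
        fun z => arc_ne_zero (hh _) (hh _) (hdist i z.1 z.2)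
      refine ⟨⟨fun z => align (h (z.1, min z.2 (u i))) (h (z.1, min z.2 (u (i + 1)))) * p z,
        (continuous_align (by fun_prop) (by fun_prop) harc).mul p.continuous⟩, ?_, ?_, ?_⟩
      · intro s t
        change rotate (_ * p (s, t)) _ = _
        rw [rotate_mul, hp]
        exact rotate_align (hh _) (hh _) (harc (s, t))
      · intro s
        change align (h (s, min 0 (u i))) (h (s, min 0 (u (i + 1)))) * p (s, 0) = 1
        rw [hp0, min_eq_left unitInterval.nonneg', min_eq_left unitInterval.nonneg',
          align_self (hh _), mul_one]
      -- Where the path is constant each factor is `align v v = 1`. This normalization later keeps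
      -- the sides of the square fixed.
      · intro s hs t
        change align (h (s, min t (u i))) (h (s, min t (u (i + 1)))) * p (s, t) = 1
        rw [hp1 s hs, hs, hs (min t _), align_self (hh _), mul_one]
  obtain ⟨p, hp, hp0, hp1⟩ := key k
  refine ⟨p, fun s t => ?_, hp0, hp1⟩
  rw [hp, hk k le_rfl, min_eq_left unitInterval.le_one']

/-! ### Rotations about the third axis -/

/-- The third vector of the standard basis. -/
def axis : Space3 := !₂[0, 0, 1]

theorem norm_axis : ‖axis‖ = 1 := by
  rw [norm_eq_sqrt_real_inner, inner_eq]
  simp [axis]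

/-- The unit quaternion `cos θ + k sin θ`, which acts as the rotation through the angle `2θ` about
the third axis. -/
def axial (θ : ℝ) : UnitQuaternion :=
  ⟨quaternion (Real.cos θ) 0 0 (Real.sin θ), quaternion_mem_sphere (by simp)⟩

@[fun_prop]
theorem continuous_axial : Continuous axial := by
  exact Continuous.subtype_mk (by fun_prop) _

theorem axial_zero : axial 0 = 1 := by
  ext <;> simp [axial]

theorem axial_two_pi : axial (2 * Real.pi) = 1 := by
  ext <;> simp [axial]

theorem rotate_axial_axis (θ : ℝ) : rotate (axial θ) axis = axis := by
  have h := Real.cos_sq_add_sin_sq θ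
  apply ext' <;> simp [rotate_coord_zero, rotate_coord_one, rotate_coord_two, axial, axis, h]

/-- The third coordinate gives $a^2-b^2-c^2+d^2=1$; comparison with $a^2+b^2+c^2+d^2=1$ leaves
$b=c=0$. -/
theorem imI_eq_zero_of_rotate_axis {q : UnitQuaternion} (hq : rotate q axis = axis) :
    (q : ℍ[ℝ]).imI = 0 ∧ (q : ℍ[ℝ]).imJ = 0 := by
  have h := congrArg (fun v : Space3 => v 2) hq
  have h1 := normSq_coe q
  simp [rotate_coord_two, axis] at h
  constructor <;> nlinarith

/-- The point of the unit circle with the coordinates of a stabilizer of the third axis. -/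
def stabilizerCircle (q : UnitQuaternion) (hq : rotate q axis = axis) : Circle :=
  ⟨⟨(q : ℍ[ℝ]).re, (q : ℍ[ℝ]).imK⟩, by
    obtain ⟨h1, h2⟩ := imI_eq_zero_of_rotate_axis hq
    have h := normSq_coe q
    rw [h1, h2] at h
    change _ ∈ sphere (0 : ℂ) 1
    rw [mem_sphere_zero_iff_norm, ← pow_eq_one_iff_of_nonneg (norm_nonneg _) two_ne_zero,
      ← Complex.normSq_eq_norm_sq, Complex.normSq_mk]
    linarith⟩

theorem eq_axial {q : UnitQuaternion} (hq : rotate q axis = axis) {θ : ℝ}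
    (h : Circle.exp θ = stabilizerCircle q hq) : q = axial θ := by
  obtain ⟨h1, h2⟩ := imI_eq_zero_of_rotate_axis hq
  have h3 := congrArg Subtype.val h
  change Complex.exp (θ * Complex.I) = _ at h3
  have hre := congrArg Complex.re h3
  have him := congrArg Complex.im h3
  rw [Complex.exp_ofReal_mul_I_re] at hre
  rw [Complex.exp_ofReal_mul_I_im] at him
  ext
  · exact hre.symm
  · exact h1
  · exact h2
  · exact him.symm

theorem exists_eq_axial {q : UnitQuaternion} (hq : rotate q axis = axis) : ∃ θ, q = axial θ := by
  obtain ⟨θ, hθ⟩ := Circle.exp_surjective (stabilizerCircle q hq)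
  exact ⟨θ, eq_axial hq hθ⟩

/-- The stabilizer of the axis is a circle, and paths in it lift through the covering `Circle.exp`.
-/
theorem exists_lift_axial (q : C(I, UnitQuaternion)) (hq : ∀ t, rotate (q t) axis = axis)
    (h0 : q 0 = 1) : ∃ θ : C(I, ℝ), θ 0 = 0 ∧ ∀ t, q t = axial (θ t) := by
  let c : C(I, Circle) := ⟨fun t => stabilizerCircle (q t) (hq t), by
    refine Continuous.subtype_mk ?_ _
    have e : (fun t => (⟨(q t : ℍ[ℝ]).re, (q t : ℍ[ℝ]).imK⟩ : ℂ))
        = fun t => ((q t : ℍ[ℝ]).re : ℂ) + ((q t : ℍ[ℝ]).imK : ℂ) * Complex.I := by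
      funext t
      apply Complex.ext <;> simp
    rw [e]
    have h1 := Quaternion.continuous_re
    have h2 := Quaternion.continuous_imK
    fun_prop⟩
  have hc : c 0 = Circle.exp 0 := by
    ext
    change (⟨(q 0 : ℍ[ℝ]).re, (q 0 : ℍ[ℝ]).imK⟩ : ℂ) = _
    rw [h0]
    apply Complex.ext <;> simp
  refine ⟨Circle.isCoveringMap_exp.liftPath c 0 hc, Circle.isCoveringMap_exp.liftPath_zero _ _ _,
    fun t => eq_axial (hq t) ?_⟩
  exact congrFun (Circle.isCoveringMap_exp.liftPath_lifts c 0 hc) t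

theorem exists_eq_of_axial_eq_one {θ : ℝ} (h : axial θ = 1) : ∃ m : ℤ, θ = m * (2 * Real.pi) := by
  have h1 := congrArg (fun q : UnitQuaternion => (q : ℍ[ℝ]).re) h
  change Real.cos θ = 1 at h1
  obtain ⟨m, hm⟩ := (Real.cos_eq_one_iff θ).1 h1
  exact ⟨m, hm.symm⟩

/-- Every unit vector is the image of the third axis under a rotation. -/
theorem exists_rotate_axis {v : Space3} (hv : ‖v‖ = 1) : ∃ q, rotate q axis = v := by
  by_cases h : arc axis v = 0
  · have h1 : (arc axis v).re = 1 + v 2 := by simp [arc, toQuaternion, axis]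
    have h2 : inner ℝ v v = (1 : ℝ) := by rw [real_inner_self_eq_norm_sq, hv, one_pow]
    rw [h, Quaternion.re_zero] at h1
    rw [inner_eq] at h2
    have h3 : v 2 = -1 := by linarith
    rw [h3] at h2
    -- In the antipodal case the half turn about the first axis, the quaternion $i$, does it.
    refine ⟨⟨quaternion 0 1 0 0, quaternion_mem_sphere (by simp)⟩, ext' ?_ ?_ ?_⟩
    · simp [rotate_coord_zero, axis]; nlinarith
    · simp [rotate_coord_one, axis]; nlinarith
    · simp [rotate_coord_two, axis]; linarith
  · exact ⟨_, rotate_align norm_axis hv h⟩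

end Space3

instance : SimplyConnectedSpace UnitQuaternion :=
  simplyConnectedSpace_sphere (by rw [Quaternion.finrank_eq_four]; norm_num)

end

noncomputable section

open Metric Set Topology

/-! ### Rotations of necklaces -/

namespace OrientedCircle

theorem ext' {K L : OrientedCircle} (hc : K.center = L.center) (hr : K.radius = L.radius)
    (hn : K.normal = L.normal) : K = L := by
  cases K; cases L; simp_all

theorem continuous_iff {Z : Type*} [TopologicalSpace Z] {f : Z → OrientedCircle} :
    Continuous f ↔ (Continuous fun z => (f z).center) ∧ (Continuous fun z => (f z).radius) ∧
      Continuous fun z => (f z).normal := by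
  rw [continuous_induced_rng, continuous_prodMk, continuous_prodMk]
  rfl

@[fun_prop]
theorem continuous_center : Continuous OrientedCircle.center := (continuous_iff.1 continuous_id).1

@[fun_prop]
theorem continuous_radius : Continuous OrientedCircle.radius :=
  (continuous_iff.1 continuous_id).2.1

@[fun_prop]
theorem continuous_normal : Continuous OrientedCircle.normal :=
  (continuous_iff.1 continuous_id).2.2

/-- The image of an oriented circle under a rotation. -/
def rotate (q : UnitQuaternion) (K : OrientedCircle) : OrientedCircle where
  center := Space3.rotate q K.center
  radius := K.radius
  normal := Space3.rotate q K.normal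
  radius_pos := K.radius_pos
  norm_normal := (Space3.norm_rotate q _).trans K.norm_normal

theorem rotate_one (K : OrientedCircle) : rotate 1 K = K :=
  ext' (Space3.rotate_one _) rfl (Space3.rotate_one _)

theorem rotate_mul (p q : UnitQuaternion) (K : OrientedCircle) :
    rotate (p * q) K = rotate p (rotate q K) :=
  ext' (Space3.rotate_mul _ _ _) rfl (Space3.rotate_mul _ _ _)

theorem continuous_rotate {Z : Type*} [TopologicalSpace Z] {q : Z → UnitQuaternion}
    {K : Z → OrientedCircle} (hq : Continuous q) (hK : Continuous K) :
    Continuous fun z => rotate (q z) (K z) := by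
  obtain ⟨h1, h2, h3⟩ := continuous_iff.1 hK
  exact continuous_iff.2 ⟨Space3.continuous_rotate hq h1, h2, Space3.continuous_rotate hq h3⟩

theorem line_subset_plane_iff (K : OrientedCircle) :
    (line[ℝ, (0 : Space3), K.center] : Set Space3) ⊆ K.plane ↔
      inner ℝ K.center K.normal = 0 := by
  constructor
  · intro h
    have h0 : inner ℝ (0 - K.center) K.normal = 0 := h (left_mem_affineSpan_pair ℝ _ _)
    simpa [inner_neg_left] using h0
  · intro h x hx
    obtain ⟨t, rfl⟩ := mem_affineSpan_pair_iff_exists_lineMap_eq.1 hx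
    simp [plane, AffineMap.lineMap_apply, inner_sub_left, inner_smul_left, h]

theorem mem_carrier_iff {K : OrientedCircle} (hc : K.center = 0) (hr : K.radius = 1) (v : Space3) :
    v ∈ K.carrier ↔ inner ℝ v K.normal = 0 ∧ ‖v‖ = 1 := by
  simp [carrier, plane, hc, hr]

end OrientedCircle

theorem IsNecklace.rotate {n : ℕ} {K₀ : OrientedCircle} {K : Fin n → OrientedCircle}
    (h : IsNecklace K₀ K) (q : UnitQuaternion) :
    IsNecklace (K₀.rotate q) fun i => (K i).rotate q where
  core_center := by
    change Space3.rotate q _ = _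
    rw [h.core_center, Space3.rotate_zero]
  core_radius := h.core_radius
  center_mem i := by
    have h1 := (OrientedCircle.mem_carrier_iff h.core_center h.core_radius _).1 (h.center_mem i)
    have hc : (K₀.rotate q).center = 0 := by
      change Space3.rotate q _ = _
      rw [h.core_center, Space3.rotate_zero]
    rw [OrientedCircle.mem_carrier_iff hc h.core_radius]
    exact ⟨(Space3.inner_rotate_rotate _ _ _).trans h1.1, (Space3.norm_rotate _ _).trans h1.2⟩
  radius_lt i := h.radius_lt i
  line_subset i := by
    rw [OrientedCircle.line_subset_plane_iff]
    exact (Space3.inner_rotate_rotate _ _ _).trans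
      ((OrientedCircle.line_subset_plane_iff _).1 (h.line_subset i))
  perp i := (Space3.inner_rotate_rotate _ _ _).trans (h.perp i)
  linking i := by
    have := h.linking i
    rwa [← Space3.inner_rotate_rotate q, ← Space3.cross3_rotate_rotate] at this
  radius_ne i j hij hc := by
    refine h.radius_ne i j hij ?_
    have := congrArg (Space3.rotate q⁻¹) hc
    simpa only [OrientedCircle.rotate, ← Space3.rotate_mul, inv_mul_cancel, Space3.rotate_one]
      using this

/-! ### The rotation action on necklaces and the normal of the core -/

namespace Necklace

variable {n : ℕ}

/-- The necklace with unlabelled components underlying a labelled one. -/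
def Conf.mk (p : OrdConf n) : Conf n :=
  Quotient.mk (MulAction.orbitRel (Equiv.Perm (Fin n)) (OrdConf n)) p

theorem Conf.mk_eq_mk_iff {p p' : OrdConf n} :
    Conf.mk p = Conf.mk p' ↔ ∃ σ : Equiv.Perm (Fin n), σ • p' = p :=
  Quotient.eq (r := MulAction.orbitRel (Equiv.Perm (Fin n)) (OrdConf n))

theorem Conf.mk_surjective : Function.Surjective (Conf.mk (n := n)) := Quotient.mk_surjective

instance : ContinuousConstSMul (Equiv.Perm (Fin n)) (OrdConf n) where
  continuous_const_smul σ := by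
    refine Continuous.subtype_mk (continuous_subtype_val.fst.prodMk (continuous_pi fun i => ?_)) _
    exact (continuous_apply (σ⁻¹ i)).comp continuous_subtype_val.snd

theorem isOpenQuotientMap_mk : IsOpenQuotientMap (Conf.mk (n := n)) :=
  MulAction.isOpenQuotientMap_quotientMk

/-- The image of a labelled necklace under a rotation. -/
def OrdConf.rotate (q : UnitQuaternion) (p : OrdConf n) : OrdConf n :=
  ⟨(p.1.1.rotate q, fun i => (p.1.2 i).rotate q), p.2.rotate q⟩

theorem OrdConf.continuous_rotate :
    Continuous fun z : UnitQuaternion × OrdConf n => OrdConf.rotate z.1 z.2 := by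
  have h : Continuous fun z : UnitQuaternion × OrdConf n => z.2.1 :=
    continuous_subtype_val.comp continuous_snd
  refine Continuous.subtype_mk (Continuous.prodMk ?_ (continuous_pi fun i => ?_)) _
  · exact OrientedCircle.continuous_rotate continuous_fst h.fst
  · exact OrientedCircle.continuous_rotate continuous_fst ((continuous_apply i).comp h.snd)

/-- The image of a necklace under a rotation. -/
def Conf.rotate (q : UnitQuaternion) : Conf n → Conf n :=
  Quotient.map (sa := MulAction.orbitRel (Equiv.Perm (Fin n)) (OrdConf n))
    (sb := MulAction.orbitRel (Equiv.Perm (Fin n)) (OrdConf n)) (OrdConf.rotate q) (by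
    rintro _ p ⟨σ, rfl⟩
    exact ⟨σ, rfl⟩)

theorem Conf.rotate_mk (q : UnitQuaternion) (p : OrdConf n) :
    Conf.rotate q (Conf.mk p) = Conf.mk (p.rotate q) := rfl

theorem Conf.rotate_one (x : Conf n) : Conf.rotate 1 x = x := by
  obtain ⟨p, rfl⟩ := Conf.mk_surjective x
  rw [Conf.rotate_mk]
  congr 1
  exact Subtype.ext (Prod.ext (OrientedCircle.rotate_one _)
    (funext fun _ => OrientedCircle.rotate_one _))

theorem Conf.rotate_mul (q q' : UnitQuaternion) (x : Conf n) :
    Conf.rotate (q * q') x = Conf.rotate q (Conf.rotate q' x) := by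
  obtain ⟨p, rfl⟩ := Conf.mk_surjective x
  simp only [Conf.rotate_mk]
  congr 1
  exact Subtype.ext (Prod.ext (OrientedCircle.rotate_mul _ _ _)
    (funext fun _ => OrientedCircle.rotate_mul _ _ _))

theorem Conf.rotate_rotate_inv (q : UnitQuaternion) (x : Conf n) :
    Conf.rotate q (Conf.rotate q⁻¹ x) = x := by
  rw [← Conf.rotate_mul, mul_inv_cancel, Conf.rotate_one]

@[fun_prop]
theorem Conf.continuous_rotate {Z : Type*} [TopologicalSpace Z] {q : Z → UnitQuaternion}
    {x : Z → Conf n} (hq : Continuous q) (hx : Continuous x) :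
    Continuous fun z => Conf.rotate (q z) (x z) := by
  -- The quotient map is open, so its product with the identity is again a quotient map, and
  -- continuity can be tested on labelled necklaces.
  have h : IsOpenQuotientMap (Prod.map id Conf.mk : UnitQuaternion × OrdConf n → _) :=
    IsOpenQuotientMap.id.prodMap isOpenQuotientMap_mk
  have h' : Continuous fun z : UnitQuaternion × Conf n => Conf.rotate z.1 z.2 := by
    rw [← h.continuous_comp_iff]
    exact isOpenQuotientMap_mk.continuous.comp OrdConf.continuous_rotate
  have h2 := h'.comp (hq.prodMk hx)
  exact h2

/-- The oriented unit normal of the core of a necklace. -/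
def Conf.coreNormal : Conf n → Space3 :=
  Quotient.lift (s := MulAction.orbitRel (Equiv.Perm (Fin n)) (OrdConf n))
    (fun p => p.1.1.normal) (by
    rintro _ p ⟨σ, rfl⟩
    rfl)

@[fun_prop]
theorem Conf.continuous_coreNormal : Continuous (Conf.coreNormal (n := n)) := by
  rw [← isOpenQuotientMap_mk.continuous_comp_iff]
  exact OrientedCircle.continuous_normal.comp continuous_subtype_val.fst

theorem Conf.norm_coreNormal (x : Conf n) : ‖x.coreNormal‖ = 1 := by
  obtain ⟨p, rfl⟩ := Conf.mk_surjective x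
  exact p.1.1.norm_normal

theorem Conf.coreNormal_rotate (q : UnitQuaternion) (x : Conf n) :
    (Conf.rotate q x).coreNormal = Space3.rotate q x.coreNormal := by
  obtain ⟨p, rfl⟩ := Conf.mk_surjective x
  rfl

theorem Conf.coreNormal_rotate_inv {q : UnitQuaternion} {x : Conf n}
    (h : Space3.rotate q Space3.axis = x.coreNormal) :
    (Conf.rotate q⁻¹ x).coreNormal = Space3.axis := by
  rw [Conf.coreNormal_rotate, ← h, ← Space3.rotate_mul, inv_mul_cancel, Space3.rotate_one]

end Necklace

/-! ### Necklaces with the standard core -/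

namespace CircularBraid

variable {n : ℕ}

theorem Conf.mk_surjective : Function.Surjective (Conf.mk (n := n)) := Quotient.mk_surjective

instance : ContinuousConstSMul (Equiv.Perm (Fin n)) (OrdConf n) where
  continuous_const_smul σ := by
    refine Continuous.subtype_mk (continuous_pi fun i => ?_) _
    exact (continuous_apply (σ⁻¹ i)).comp continuous_subtype_val

theorem isOpenQuotientMap_mk : IsOpenQuotientMap (Conf.mk (n := n)) :=
  MulAction.isOpenQuotientMap_quotientMk

end CircularBraid

/-! ### Points of the punctured plane as beads -/

namespace PuncturedPlane

open CircularBraid Space3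

theorem norm_pos (z : PuncturedPlane) : 0 < ‖(z : ℂ)‖ := norm_pos_iff.2 z.2

theorem re_sq_add_im_sq (z : PuncturedPlane) :
    ((z : ℂ).re / ‖(z : ℂ)‖) ^ 2 + ((z : ℂ).im / ‖(z : ℂ)‖) ^ 2 = 1 := by
  have h := norm_pos z
  have h2 : (z : ℂ).re ^ 2 + (z : ℂ).im ^ 2 = ‖(z : ℂ)‖ ^ 2 := by
    rw [← Complex.normSq_eq_norm_sq, Complex.normSq_apply]; ring
  field_simp
  linarith

/-- The component, around the standard core, that corresponds to a point of the punctured plane: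
its argument gives the centre, and its modulus the radius. -/
def bead (z : PuncturedPlane) : OrientedCircle where
  center := !₂[(z : ℂ).re / ‖(z : ℂ)‖, (z : ℂ).im / ‖(z : ℂ)‖, 0]
  -- The map $\rho\mapsto\rho/(2(1+\rho))$ takes $(0,\infty)$ onto $(0,\frac12)$, with inverse
  -- $r\mapsto 2r/(1-2r)$.
  radius := ‖(z : ℂ)‖ / (2 * (1 + ‖(z : ℂ)‖))
  normal := !₂[-((z : ℂ).im / ‖(z : ℂ)‖), (z : ℂ).re / ‖(z : ℂ)‖, 0]
  radius_pos := by have := norm_pos z; positivity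
  norm_normal := by
    rw [norm_eq_sqrt_real_inner, inner_eq]
    simpa [← sq, add_comm] using re_sq_add_im_sq z

@[fun_prop]
theorem continuous_bead : Continuous bead := by
  have h : ∀ z : PuncturedPlane, ‖(z : ℂ)‖ ≠ 0 := fun z => (norm_pos z).ne'
  have h' : ∀ z : PuncturedPlane, 2 * (1 + ‖(z : ℂ)‖) ≠ 0 := fun z => by
    have := norm_pos z; positivity
  refine OrientedCircle.continuous_iff.2 ⟨?_, ?_, ?_⟩ <;> simp only [bead] <;>
    fun_prop (disch := assumption)

/-- The point of the plane that corresponds to a component around the standard core. -/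
def ofBead (K : OrientedCircle) : ℂ :=
  ((2 * K.radius / (1 - 2 * K.radius) : ℝ) : ℂ) * (K.center 0 + K.center 1 * Complex.I)

theorem ofBead_bead (z : PuncturedPlane) : ofBead (bead z) = z := by
  have h := norm_pos z
  have h2 : 2 * (bead z).radius / (1 - 2 * (bead z).radius) = ‖(z : ℂ)‖ := by
    simp only [bead]
    have : 1 - 2 * (‖(z : ℂ)‖ / (2 * (1 + ‖(z : ℂ)‖))) = 1 / (1 + ‖(z : ℂ)‖) := by
      field_simp; ring
    rw [this]
    field_simp
  rw [ofBead, h2]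
  apply Complex.ext <;> simp [bead] <;> field_simp

/-- Conjugation doubles the angle, whence the factor $2\theta$ in the exponential. -/
theorem bead_exp_mul (θ : ℝ) (z w : PuncturedPlane)
    (h : (w : ℂ) = Complex.exp (2 * θ * Complex.I) * z) :
    bead w = (bead z).rotate (axial θ) := by
  have hexp : Complex.exp (2 * θ * Complex.I) = Complex.exp ((2 * θ : ℝ) * Complex.I) := by
    push_cast; rfl
  rw [hexp] at h
  have hn : ‖(w : ℂ)‖ = ‖(z : ℂ)‖ := by
    rw [h, norm_mul, Complex.norm_exp_ofReal_mul_I, one_mul]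
  have hre : (w : ℂ).re = (Real.cos θ ^ 2 - Real.sin θ ^ 2) * (z : ℂ).re
      - 2 * Real.sin θ * Real.cos θ * (z : ℂ).im := by
    rw [h, Complex.mul_re, Complex.exp_ofReal_mul_I_re, Complex.exp_ofReal_mul_I_im,
      Real.cos_two_mul', Real.sin_two_mul]
  have him : (w : ℂ).im = (Real.cos θ ^ 2 - Real.sin θ ^ 2) * (z : ℂ).im
      + 2 * Real.sin θ * Real.cos θ * (z : ℂ).re := by
    rw [h, Complex.mul_im, Complex.exp_ofReal_mul_I_re, Complex.exp_ofReal_mul_I_im,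
      Real.cos_two_mul', Real.sin_two_mul]
  refine OrientedCircle.ext' ?_ ?_ ?_
  · apply Space3.ext' <;> simp [bead, OrientedCircle.rotate, rotate_coord_zero, rotate_coord_one,
      rotate_coord_two, axial, hre, him, hn] <;> ring
  · simp [bead, OrientedCircle.rotate, hn]
  · apply Space3.ext' <;> simp [bead, OrientedCircle.rotate, rotate_coord_zero, rotate_coord_one,
      rotate_coord_two, axial, hre, him, hn] <;> ring

end PuncturedPlane

namespace OrientedCircle

/-- The unit circle about the origin in the horizontal plane. -/
def standardCore : OrientedCircle := ⟨0, 1, Space3.axis, one_pos, Space3.norm_axis⟩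

end OrientedCircle

namespace IsNecklace

open Space3 PuncturedPlane OrientedCircle CircularBraid

variable {n : ℕ}

theorem of_injective {f : Fin n → PuncturedPlane} (hf : Function.Injective f) :
    IsNecklace standardCore fun i => bead (f i) where
  core_center := rfl
  core_radius := rfl
  center_mem i := by
    rw [mem_carrier_iff rfl rfl, norm_eq_sqrt_real_inner, inner_eq, inner_eq]
    have h := re_sq_add_im_sq (f i)
    simp [bead, standardCore, axis, ← sq, h]
  radius_lt i := by
    have h := norm_pos (f i)
    simp only [bead]
    rw [div_lt_div_iff₀ (by positivity) (by positivity)]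
    linarith
  line_subset i := by
    rw [line_subset_plane_iff, inner_eq]
    simp [bead]
    ring
  perp i := by
    rw [inner_eq]
    simp [bead, standardCore, axis]
  linking i := by
    have h := re_sq_add_im_sq (f i)
    rw [inner_eq, cross3_zero, cross3_one, cross3_two]
    simp only [bead, standardCore, axis]
    simp
    nlinarith
  radius_ne i j hij hc hr := by
    refine hij (hf (Subtype.ext ?_))
    rw [← ofBead_bead (f i), ← ofBead_bead (f j), ofBead, ofBead, hc, hr]

theorem ofBead_spec {K₀ : OrientedCircle} {K : Fin n → OrientedCircle} (h : IsNecklace K₀ K)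
    (hK : K₀.normal = axis) (i : Fin n) :
    ∃ hz : ofBead (K i) ≠ 0, bead ⟨ofBead (K i), hz⟩ = K i := by
  obtain ⟨hc, hc1⟩ := (mem_carrier_iff h.core_center h.core_radius _).1 (h.center_mem i)
  have hperp := h.perp i
  have hlink := h.linking i
  have hline := (line_subset_plane_iff _).1 (h.line_subset i)
  have hr := h.radius_lt i
  have hr0 := (K i).radius_pos
  have hn1 := (K i).norm_normal
  rw [norm_eq_sqrt_real_inner, Real.sqrt_eq_one, inner_eq] at hc1 hn1
  rw [hK, inner_eq] at hc hperp
  rw [hK, inner_eq, cross3_zero, cross3_one, cross3_two] at hlink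
  rw [inner_eq] at hline
  simp [axis] at hc hperp hlink
  simp [hc, hperp] at hline hn1 hc1
  set c₀ := (K i).center 0
  set c₁ := (K i).center 1
  set ν₀ := (K i).normal 0
  set ν₁ := (K i).normal 1
  set R := 2 * (K i).radius / (1 - 2 * (K i).radius) with hR
  have hd : 0 < 1 - 2 * (K i).radius := by linarith
  have hRpos : 0 < R := by positivity
  -- The normal is horizontal and orthogonal to the centre, so it is a multiple of $(-c_1,c_0)$. The
  -- coefficient is $\pm1$ because both are unit vectors, and the linking condition selects $+1$.
  have e0 : ν₀ = -c₁ * (-(c₁ * ν₀) + c₀ * ν₁) := by linear_combination (-ν₀) * hc1 + c₀ * hline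
  have e1 : ν₁ = c₀ * (-(c₁ * ν₀) + c₀ * ν₁) := by linear_combination (-ν₁) * hc1 + c₁ * hline
  have ha : -(c₁ * ν₀) + c₀ * ν₁ = 1 := by
    have : (-(c₁ * ν₀) + c₀ * ν₁) ^ 2 = 1 := by
      linear_combination (ν₀ * ν₀ + ν₁ * ν₁) * hc1 + hn1 - (c₀ * ν₀ + c₁ * ν₁) * hline
    nlinarith
  rw [ha, mul_one] at e0 e1
  have hre : (ofBead (K i)).re = R * c₀ := by
    rw [ofBead, ← hR, Complex.re_ofReal_mul]
    simp [c₀]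
  have him : (ofBead (K i)).im = R * c₁ := by
    rw [ofBead, ← hR, Complex.im_ofReal_mul]
    simp [c₁]
  have hnorm : ‖ofBead (K i)‖ = R := by
    rw [← sq_eq_sq₀ (norm_nonneg _) hRpos.le, ← Complex.normSq_eq_norm_sq, Complex.normSq_apply,
      hre, him]
    linear_combination R ^ 2 * hc1
  refine ⟨fun h0 => ?_, ?_⟩
  · rw [h0, norm_zero] at hnorm
    exact hRpos.ne hnorm
  · refine OrientedCircle.ext' ?_ ?_ ?_
    · apply Space3.ext' <;> simp only [bead, hre, him, hnorm]
      · exact mul_div_cancel_left₀ _ hRpos.ne'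
      · exact mul_div_cancel_left₀ _ hRpos.ne'
      · exact hc.symm
    · simp only [bead, hnorm]
      have : 1 + R = 1 / (1 - 2 * (K i).radius) := by
        rw [hR]; field_simp; ring
      rw [this, hR]
      field_simp
    · apply Space3.ext' <;> simp only [bead, hre, him, hnorm]
      · exact (congrArg Neg.neg (mul_div_cancel_left₀ _ hRpos.ne')).trans e0.symm
      · exact (mul_div_cancel_left₀ _ hRpos.ne').trans e1.symm
      · exact hperp.symm

end IsNecklace

/-! ### The fibre over the third axis -/

namespace CircularBraid

open Space3 PuncturedPlane OrientedCircle

variable {n : ℕ}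

/-- The labelled necklace with the standard core that corresponds to a configuration of points in
the punctured plane. -/
def OrdConf.necklace (f : OrdConf n) : Necklace.OrdConf n :=
  ⟨(standardCore, fun i => bead (f.1 i)), IsNecklace.of_injective f.2⟩

theorem OrdConf.continuous_necklace : Continuous (OrdConf.necklace (n := n)) := by
  refine Continuous.subtype_mk (continuous_const.prodMk (continuous_pi fun i => ?_)) _
  exact continuous_bead.comp ((continuous_apply i).comp continuous_subtype_val)

/-- `ofBead` provides a continuous left inverse, up to the inclusion of configurations in $\mathbb
C^n$. -/
theorem OrdConf.isEmbedding_necklace : IsEmbedding (OrdConf.necklace (n := n)) := by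
  let g : Necklace.OrdConf n → Fin n → ℂ := fun p i => ofBead (p.1.2 i)
  have hg : Continuous g := by
    refine continuous_pi fun i => ?_
    have hK : Continuous fun p : Necklace.OrdConf n => p.1.2 i :=
      (continuous_apply i).comp continuous_subtype_val.snd
    have hd : ∀ p : Necklace.OrdConf n, 1 - 2 * (p.1.2 i).radius ≠ 0 := fun p => by
      have := p.2.radius_lt i
      linarith
    have h1 := continuous_radius.comp hK
    have h2 := continuous_center.comp hK
    simp only [Function.comp_def] at h1 h2
    simp only [g, ofBead]
    fun_prop (disch := assumption)
  refine IsEmbedding.of_comp OrdConf.continuous_necklace hg ?_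
  have e : g ∘ OrdConf.necklace = fun f i => (f.1 i : ℂ) := by
    funext f i
    exact ofBead_bead _
  rw [e]
  exact (IsEmbedding.piMap fun _ : Fin n => IsEmbedding.subtypeVal).comp IsEmbedding.subtypeVal

theorem OrdConf.exists_necklace_eq {p : Necklace.OrdConf n} (hp : p.1.1.normal = axis) :
    ∃ f : OrdConf n, f.necklace = p := by
  choose hz hb using p.2.ofBead_spec hp
  refine ⟨⟨fun i => ⟨ofBead (p.1.2 i), hz i⟩, fun i j hij => ?_⟩, ?_⟩
  · by_contra hne
    have e : p.1.2 i = p.1.2 j := by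
      rw [← hb i, ← hb j]
      exact congrArg bead hij
    -- Equal points would be equal beads, with the same centre and the same radius.
    exact p.2.radius_ne i j hne (congrArg _ e) (congrArg _ e)
  · refine Subtype.ext (Prod.ext (OrientedCircle.ext' ?_ ?_ hp.symm) (funext hb))
    · exact p.2.core_center.symm
    · exact p.2.core_radius.symm

/-- The necklace with the standard core that corresponds to a configuration of points in the
punctured plane. -/
def Conf.necklace : Conf n → Necklace.Conf n :=
  Quotient.map (sa := MulAction.orbitRel (Equiv.Perm (Fin n)) (OrdConf n))
    (sb := MulAction.orbitRel (Equiv.Perm (Fin n)) (Necklace.OrdConf n)) OrdConf.necklace (by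
    rintro _ f ⟨σ, rfl⟩
    exact ⟨σ, rfl⟩)

theorem Conf.necklace_mk (f : OrdConf n) :
    (Conf.mk f).necklace = Necklace.Conf.mk f.necklace := rfl

theorem OrdConf.necklace_smul (σ : Equiv.Perm (Fin n)) (f : OrdConf n) :
    (σ • f).necklace = σ • f.necklace := rfl

/-- The embedding of labelled configurations is equivariant and its image is a union of orbits, so
it descends to an embedding of the quotients. -/
theorem Conf.isEmbedding_necklace : IsEmbedding (Conf.necklace (n := n)) := by
  refine isEmbedding_of_isOpenQuotientMap_of_isInducing OrdConf.necklace Conf.necklace Conf.mk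
    Necklace.Conf.mk rfl OrdConf.isEmbedding_necklace.isInducing
    isOpenQuotientMap_mk.isQuotientMap Necklace.isOpenQuotientMap_mk ?_ ?_
  · intro x y hxy
    obtain ⟨f, rfl⟩ := Conf.mk_surjective x
    obtain ⟨g, rfl⟩ := Conf.mk_surjective y
    obtain ⟨σ, hσ⟩ := Necklace.Conf.mk_eq_mk_iff.1 hxy
    rw [← OrdConf.necklace_smul] at hσ
    exact Quotient.sound (s := MulAction.orbitRel (Equiv.Perm (Fin n)) (OrdConf n))
      ⟨σ, OrdConf.isEmbedding_necklace.injective hσ⟩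
  · rintro p ⟨_, ⟨f, rfl⟩, hf⟩
    obtain ⟨σ, hσ⟩ := Necklace.Conf.mk_eq_mk_iff.1 hf.symm
    exact ⟨σ • f, hσ⟩

theorem Conf.coreNormal_necklace (f : Conf n) : f.necklace.coreNormal = axis := by
  obtain ⟨f, rfl⟩ := Conf.mk_surjective f
  rfl

theorem Conf.exists_necklace_eq {x : Necklace.Conf n} (hx : x.coreNormal = axis) :
    ∃ f : Conf n, f.necklace = x := by
  obtain ⟨p, rfl⟩ := Necklace.Conf.mk_surjective x
  obtain ⟨f, rfl⟩ := OrdConf.exists_necklace_eq hx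
  exact ⟨Conf.mk f, rfl⟩

/-- A family of necklaces with the standard core comes from a family of configurations. -/
theorem Conf.exists_lift_necklace {Z : Type*} [TopologicalSpace Z] (h : C(Z, Necklace.Conf n))
    (hh : ∀ z, (h z).coreNormal = axis) : ∃ φ : C(Z, Conf n), ∀ z, (φ z).necklace = h z := by
  choose φ hφ using fun z => Conf.exists_necklace_eq (hh z)
  refine ⟨⟨φ, ?_⟩, hφ⟩
  rw [Conf.isEmbedding_necklace.continuous_iff, show Conf.necklace ∘ φ = h from funext hφ]
  exact h.continuous

theorem necklace_polygon (hn : n ≠ 0) (t : ℝ) : (Conf.mk (polygon n t)).necklace =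
    Necklace.Conf.rotate (axial (Real.pi * t / n)) (basePoint n).necklace := by
  rw [basePoint, Conf.necklace_mk, Conf.necklace_mk, Necklace.Conf.rotate_mk]
  congr 1
  refine Subtype.ext (Prod.ext (OrientedCircle.ext' (rotate_zero _).symm rfl
    (rotate_axial_axis _).symm) (funext fun k => bead_exp_mul _ _ _ ?_))
  simp only [polygon]
  rw [← Complex.exp_add]
  congr 1
  push_cast
  field_simp
  ring

/-- Any two labelled configurations are joined by a path: on the complex line through them, only
finitely many points are not configurations. -/
theorem OrdConf.joined (f g : OrdConf n) : Joined f g := by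
  -- The puncture is added as a further point `none` at $0$; being distinct and nonzero is then just
  -- injectivity.
  let ext : OrdConf n → Option (Fin n) → ℂ := fun f i => i.elim 0 fun i => f.1 i
  have hext : ∀ f, Function.Injective (ext f) := by
    rintro f (_ | i) (_ | j) h
    · rfl
    · exact absurd h.symm (f.1 j).2
    · exact absurd h (f.1 i).2
    · exact congrArg some (f.2 (Subtype.ext h))
  let c : ℂ → Option (Fin n) → ℂ := fun z i => ext f i + z * (ext g i - ext f i)
  let bad : Set ℂ := ⋃ i, ⋃ j, ⋃ _ : i ≠ j, {z | c z i = c z j}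
  have hbad : bad.Countable := by
    refine countable_iUnion fun i => countable_iUnion fun j => countable_iUnion fun hij =>
      Set.Subsingleton.countable fun z hz w hw => ?_
    by_contra hne
    change c z i = c z j at hz
    change c w i = c w j at hw
    simp only [c] at hz hw
    have h1 : (z - w) * ((ext g i - ext f i) - (ext g j - ext f j)) = 0 := by
      linear_combination hz - hw
    have h2 := (mul_eq_zero.1 h1).resolve_left (sub_ne_zero.2 hne)
    exact hij (hext f (by linear_combination hz - z * h2))
  have hgood : ∀ z ∈ badᶜ, Function.Injective (c z) := by
    intro z hz i j hij
    by_contra hne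
    exact hz (mem_iUnion.2 ⟨i, mem_iUnion.2 ⟨j, mem_iUnion.2 ⟨hne, hij⟩⟩⟩)
  have hmem : ∀ z, Function.Injective (c z) → z ∈ badᶜ := by
    intro z hz h
    obtain ⟨i, hi⟩ := mem_iUnion.1 h
    obtain ⟨j, hj⟩ := mem_iUnion.1 hi
    obtain ⟨hij, h⟩ := mem_iUnion.1 hj
    exact hij (hz h)
  have h0 : (0 : ℂ) ∈ badᶜ := hmem _ (by simpa [c] using hext f)
  have h1 : (1 : ℂ) ∈ badᶜ := hmem _ (by simpa [c] using hext g)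
  have hrank : 1 < Module.rank ℝ ℂ := by simp [Complex.rank_real_complex]
  -- A countable set does not disconnect the complex line, which has real dimension $2$.
  obtain ⟨γ, hγ⟩ := (hbad.isPathConnected_compl_of_one_lt_rank hrank).joinedIn 0 h0 1 h1
  have hcnone : ∀ z, c z none = 0 := fun z => by simp [c, ext]
  refine ⟨⟨⟨fun t => ⟨fun i => ⟨c (γ t) (some i), fun h => ?_⟩, fun i j hij => ?_⟩, ?_⟩, ?_, ?_⟩⟩
  · exact Option.some_ne_none i (hgood _ (hγ t) (h.trans (hcnone _).symm))
  · exact Option.some_injective _ (hgood _ (hγ t) (congrArg Subtype.val hij))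
  · refine Continuous.subtype_mk (continuous_pi fun i => Continuous.subtype_mk ?_ _) _
    simp only [c]
    fun_prop
  · refine Subtype.ext (funext fun i => Subtype.ext ?_)
    simp [c, ext]
  · refine Subtype.ext (funext fun i => Subtype.ext ?_)
    simp [c, ext]

/-- The configuration space of the punctured plane is path connected. -/
instance : PathConnectedSpace (Conf n) where
  nonempty := ⟨basePoint n⟩
  joined x y := by
    obtain ⟨f, rfl⟩ := Conf.mk_surjective x
    obtain ⟨g, rfl⟩ := Conf.mk_surjective y
    exact ⟨(OrdConf.joined f g).somePath.map isOpenQuotientMap_mk.continuous⟩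

end CircularBraid
end

noncomputable section

open Set unitInterval Space3

namespace CircularBraid

variable {n : ℕ}

/-! ### Powers of the cyclic shift -/

theorem mk_polygon_add_one (n : ℕ) (t : ℝ) :
    Conf.mk (polygon n (t + 1)) = Conf.mk (polygon n t) := by
  refine Quotient.sound (s := MulAction.orbitRel (Equiv.Perm (Fin n)) (OrdConf n))
    ⟨(finRotate n)⁻¹, Subtype.ext (funext fun k => Subtype.ext ?_)⟩
  obtain _ | m := n
  · exact k.elim0
  change Complex.exp (2 * Real.pi * Complex.I * (((finRotate (m + 1) k : ℕ) : ℂ) + t)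
    / (m + 1 : ℕ)) = Complex.exp (2 * Real.pi * Complex.I * (((k : ℕ) : ℂ) + (t + 1 : ℝ))
      / (m + 1 : ℕ))
  rw [coe_finRotate]
  have hm : ((m : ℂ) + 1) ≠ 0 := by exact_mod_cast Nat.succ_ne_zero m
  split_ifs with h
  · subst h
    rw [Complex.exp_eq_exp_iff_exists_int]
    -- The last vertex wraps around to the first, one full period back.
    refine ⟨-1, ?_⟩
    push_cast
    field_simp
    ring
  · congr 1
    push_cast
    ring

/-- The family of turned polygons. -/
def polygonMap (n : ℕ) : C(ℝ, Conf n) where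
  toFun t := Conf.mk (polygon n t)
  continuous_toFun := by
    refine continuous_quotient_mk'.comp (Continuous.subtype_mk (continuous_pi fun k =>
      Continuous.subtype_mk ?_ _) _)
    fun_prop

theorem polygonMap_add_int (t : ℝ) (m : ℤ) : polygonMap n (t + m) = polygonMap n t := by
  have h : Function.Periodic (polygonMap n) 1 := mk_polygon_add_one n
  simpa using h.int_mul m t

theorem polygonMap_int (m : ℤ) : polygonMap n m = basePoint n := by
  have h := polygonMap_add_int (n := n) 0 m
  rw [zero_add] at h
  exact h

/-- The `m`-fold cyclic shift. -/
def shiftPath (n : ℕ) (m : ℤ) : Path (basePoint n) (basePoint n) where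
  toFun t := polygonMap n (m * t)
  continuous_toFun := by fun_prop
  source' := by simpa using polygonMap_int (n := n) 0
  target' := by simpa using polygonMap_int m

/-- The homotopy class of a loop of polygons depends only on the total angle. -/
theorem homotopic_shiftPath {m : ℤ} (δ : Path (basePoint n) (basePoint n)) (θ : C(I, ℝ))
    (h0 : θ 0 = 0) (h1 : θ 1 = m) (hδ : ∀ t, δ t = polygonMap n (θ t)) :
    δ.Homotopic (shiftPath n m) := by
  let p : Path (0 : ℝ) m := ⟨θ, h0, h1⟩
  let q : Path (0 : ℝ) m := ⟨⟨fun t => m * t, by fun_prop⟩, by simp, by simp⟩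
  have h := ((SimplyConnectedSpace.paths_homotopic p q).map (polygonMap n)).pathCast
    (x₂ := basePoint n) (x₃ := basePoint n)
    (by simpa using (polygonMap_int (n := n) 0).symm) (polygonMap_int m).symm
  convert! h using 1
  ext t
  exact hδ t

/-- The angles of the second loop may start at `m` instead of $0$, because integer shifts do not
change the polygon; the two angle paths then concatenate. -/
theorem shiftPath_trans (m k : ℤ) :
    ((shiftPath n m).trans (shiftPath n k)).Homotopic (shiftPath n (m + k)) := by
  let p : Path (0 : ℝ) m := ⟨⟨fun t => m * t, by fun_prop⟩, by simp, by simp⟩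
  let q : Path (m : ℝ) (m + k) := ⟨⟨fun t => m + k * t, by fun_prop⟩, by simp, by simp⟩
  refine homotopic_shiftPath _ (p.trans q).toContinuousMap (p.trans q).source
    ((p.trans q).target.trans (by push_cast; rfl)) fun t => ?_
  change _ = polygonMap n (p.trans q t)
  rw [Path.trans_apply, Path.trans_apply]
  split_ifs
  · rfl
  · simp only [shiftPath, Path.coe_mk_mk, q]
    rw [add_comm, polygonMap_add_int]

/-- The class of the `m`-fold cyclic shift, as a homomorphism. -/
def shiftHom (n : ℕ) : Multiplicative ℤ →* CB n :=
  MonoidHom.mk' (fun m => FundamentalGroup.fromPath (Path.Homotopic.Quotient.mk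
    (shiftPath n m.toAdd))) fun a b => by
      -- A product of classes traverses its right factor first.
      rw [mul_comm a b]
      exact (Path.Homotopic.Quotient.eq.2 (shiftPath_trans b.toAdd a.toAdd)).symm

theorem mk_shiftPath (m : ℤ) : FundamentalGroup.fromPath (Path.Homotopic.Quotient.mk
    (shiftPath n m)) = CB.zeta n ^ m := by
  have h := MonoidHom.apply_mint (CB n) (shiftHom n) (Multiplicative.ofAdd m)
  have h1 : shiftHom n (Multiplicative.ofAdd 1) = CB.zeta n := by
    change FundamentalGroup.fromPath (Path.Homotopic.Quotient.mk (shiftPath n 1)) = _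
    congr 2
    ext t
    change polygonMap n (((1 : ℤ) : ℝ) * t) = polygonMap n t
    simp
  rw [h1] at h
  exact h

/-! ### The fundamental group of the space of necklaces -/

/-- The homomorphism of fundamental groups induced by the inclusion of the necklaces with the
standard core. -/
def necklaceHom (n : ℕ) :
    CB n →* FundamentalGroup (Necklace.Conf n) (basePoint n).necklace :=
  FundamentalGroup.map ⟨Conf.necklace, Conf.isEmbedding_necklace.continuous⟩ (basePoint n)

theorem necklaceHom_mk (γ : Path (basePoint n) (basePoint n)) :
    necklaceHom n (FundamentalGroup.fromPath (Path.Homotopic.Quotient.mk γ)) =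
      FundamentalGroup.fromPath (Path.Homotopic.Quotient.mk
        (γ.map Conf.isEmbedding_necklace.continuous)) := rfl

/-- A loop of necklaces that is obtained from a loop of necklaces with the standard core by a loop of
rotations is homotopic to that loop. -/
theorem homotopic_of_rotate {x : Necklace.Conf n} (γ δ : Path x x)
    (p : Path (1 : UnitQuaternion) 1) (h : ∀ t, γ t = Necklace.Conf.rotate (p t) (δ t)) :
    γ.Homotopic δ := by
  -- The loop of rotations contracts in $S^3$ relative to its ends, so the base point stays fixed.
  obtain ⟨H⟩ := SimplyConnectedSpace.paths_homotopic p (Path.refl 1)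
  refine ⟨⟨⟨⟨fun z => Necklace.Conf.rotate (H z) (δ z.2), ?_⟩, ?_, ?_⟩, ?_⟩⟩
  · exact Necklace.Conf.continuous_rotate H.continuous (by fun_prop)
  · intro t
    simp [h]
  · intro t
    simp [Necklace.Conf.rotate_one]
  · rintro s t (rfl | rfl)
    · simp [Necklace.Conf.rotate_one]
    · simp [Necklace.Conf.rotate_one]

/-- Rotations that carry the axis along the normals of a loop can be chosen to form a loop; undoing
them moves the loop into the fibre without changing its class. -/
theorem necklaceHom_surjective : Function.Surjective (necklaceHom n) := by
  intro a
  obtain ⟨γ, rfl⟩ := Path.Homotopic.Quotient.mk_surjective a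
  have hN0 : (basePoint n).necklace.coreNormal = axis := Conf.coreNormal_necklace _
  obtain ⟨p, hp, hp0, -⟩ := exists_lift_homotopy
    ⟨fun z => (γ z.2).coreNormal, by fun_prop⟩ fun z => Necklace.Conf.norm_coreNormal _
  simp only [ContinuousMap.coe_mk, γ.source, hN0] at hp
  have hp1 := hp 0 1
  rw [γ.target, hN0] at hp1
  obtain ⟨θ, hθ⟩ := exists_eq_axial hp1
  -- The lift ends at some `axial θ`. The correction on the right closes it up and, fixing the axis,
  -- does not affect the normals.
  let q : Path (1 : UnitQuaternion) 1 :=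
    { toFun := fun t => p (0, t) * (axial (θ * t))⁻¹
      continuous_toFun := by fun_prop
      source' := by simp [hp0, axial_zero]
      target' := by simp [hθ] }
  have hq : ∀ t, rotate (q t) axis = (γ t).coreNormal := by
    intro t
    rw [← hp 0 t]
    change rotate (p (0, t) * (axial (θ * t))⁻¹) axis = _
    have := congrArg (rotate (axial (θ * t))⁻¹) (rotate_axial_axis (θ * t))
    rw [← rotate_mul, inv_mul_cancel, rotate_one] at this
    rw [rotate_mul, ← this]
  obtain ⟨φ, hφ⟩ := Conf.exists_lift_necklace
    ⟨fun t => Necklace.Conf.rotate (q t)⁻¹ (γ t),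
      Necklace.Conf.continuous_rotate q.continuous.inv γ.continuous⟩
    fun t => Necklace.Conf.coreNormal_rotate_inv (hq t)
  have hinj := (Conf.isEmbedding_necklace (n := n)).injective
  let δ : Path (basePoint n) (basePoint n) :=
    { toContinuousMap := φ
      source' := hinj (by simp [hφ, Necklace.Conf.rotate_one])
      target' := hinj (by simp [hφ, Necklace.Conf.rotate_one]) }
  refine ⟨FundamentalGroup.fromPath (Path.Homotopic.Quotient.mk δ), ?_⟩
  rw [necklaceHom_mk]
  refine (Path.Homotopic.Quotient.eq.2 (homotopic_of_rotate γ _ q fun t => ?_)).symm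
  change γ t = Necklace.Conf.rotate (q t) (φ t).necklace
  rw [hφ]
  exact (Necklace.Conf.rotate_rotate_inv _ _).symm

theorem necklaceHom_zeta_pow (hn : n ≠ 0) : necklaceHom n (CB.zeta n ^ (2 * n)) = 1 := by
  have h := mk_shiftPath (n := n) ((2 * n : ℕ) : ℤ)
  rw [zpow_natCast] at h
  rw [← h, necklaceHom_mk]
  -- One circuit of the axial circle is a rotation through $4\pi$, matching $2n$ shifts by $2\pi/n$.
  let p : Path (1 : UnitQuaternion) 1 :=
    { toFun := fun t => axial (2 * Real.pi * t)
      continuous_toFun := by fun_prop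
      source' := by simp [axial_zero]
      target' := by simp [axial_two_pi] }
  refine Path.Homotopic.Quotient.eq.2 (homotopic_of_rotate _ (Path.refl _) p fun t => ?_)
  change (Conf.mk (polygon n _)).necklace = _
  rw [necklace_polygon hn]
  change _ = Necklace.Conf.rotate (axial (2 * Real.pi * t)) _
  congr 2
  have : (n : ℝ) ≠ 0 := Nat.cast_ne_zero.2 hn
  push_cast
  field_simp

/-- Straightening a null homotopy by lifted rotations gives a square in the configuration space. Its
side `s = 0` is `γ`, two sides are constant, and at `t = 1` only axial rotations of the base polygon
remain. -/
theorem mem_zpowers_of_necklaceHom_eq_one (hn : n ≠ 0) {a : CB n} (ha : necklaceHom n a = 1) :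
    a ∈ Subgroup.zpowers (CB.zeta n ^ (2 * n)) := by
  obtain ⟨γ, rfl⟩ := Path.Homotopic.Quotient.mk_surjective a
  obtain ⟨F⟩ := Path.Homotopic.Quotient.exact (show Path.Homotopic.Quotient.mk
    (γ.map Conf.isEmbedding_necklace.continuous) = Path.Homotopic.Quotient.mk (Path.refl _) from ha)
  have hinj := (Conf.isEmbedding_necklace (n := n)).injective
  have hN0 : (basePoint n).necklace.coreNormal = axis := Conf.coreNormal_necklace _
  have hF0 : ∀ t, F (0, t) = (γ t).necklace := fun t => F.apply_zero t
  have hF1 : ∀ t, F (1, t) = (basePoint n).necklace := fun t => F.apply_one t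
  have hs0 : ∀ s, F (s, 0) = (basePoint n).necklace := fun s => F.source s
  have hs1 : ∀ s, F (s, 1) = (basePoint n).necklace := fun s => F.target s
  have hFc : Continuous F := F.continuous
  obtain ⟨p, hp, hp0, hpc⟩ := exists_lift_homotopy
    ⟨fun z => (F z).coreNormal, by fun_prop⟩ fun z => Necklace.Conf.norm_coreNormal _
  simp only [ContinuousMap.coe_mk, hs0, hN0] at hp hpc
  obtain ⟨φ, hφ⟩ := Conf.exists_lift_necklace
    ⟨fun z => Necklace.Conf.rotate (p z)⁻¹ (F z),
      Necklace.Conf.continuous_rotate p.continuous.inv hFc⟩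
    fun z => Necklace.Conf.coreNormal_rotate_inv (hp z.1 z.2)
  simp only [ContinuousMap.coe_mk] at hφ
  -- On the sides `s = 0` and `s = 1` the core is standard throughout, so the lift is trivial there.
  have hp0' : ∀ t, p (0, t) = 1 :=
    hpc 0 fun t => by rw [hF0, Conf.coreNormal_necklace]
  have hp1' : ∀ t, p (1, t) = 1 := hpc 1 fun t => by rw [hF1, hN0]
  have hstab : ∀ s, rotate (p (s, 1))⁻¹ axis = axis := by
    intro s
    have h := hp s 1
    rw [hs1, hN0] at h
    have := congrArg (rotate (p (s, 1))⁻¹) h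
    rw [← rotate_mul, inv_mul_cancel, rotate_one] at this
    exact this.symm
  obtain ⟨θ, hθ0, hθ⟩ := exists_lift_axial ⟨fun s => (p (s, 1))⁻¹, by fun_prop⟩ hstab
    (by simp [hp0'])
  simp only [ContinuousMap.coe_mk] at hθ
  obtain ⟨m, hm⟩ := exists_eq_of_axial_eq_one ((hθ 1).symm.trans (by simp [hp1']))
  have hn' : (n : ℝ) ≠ 0 := Nat.cast_ne_zero.2 hn
  -- `axial θ` turns through $2\theta$ and the polygon at time $t$ through $2\pi t/n$, so
  -- $t=n\theta/\pi$. At the end $\theta=2\pi m$ and the time is $2nm$.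
  have hφ1 : ∀ s, φ (s, 1) = polygonMap n (n * θ s / Real.pi) := by
    intro s
    apply hinj
    change _ = (Conf.mk (polygon n _)).necklace
    rw [hφ, hs1, hθ, necklace_polygon hn]
    congr 2
    have := Real.pi_ne_zero
    field_simp
  have hbase : ∀ z, F z = (basePoint n).necklace → p z = 1 → φ z = basePoint n := by
    intro z h1 h2
    apply hinj
    rw [hφ, h1, h2, inv_one, Necklace.Conf.rotate_one]
  let δ : Path (basePoint n) (basePoint n) :=
    { toFun := fun s => φ (s, 1)
      continuous_toFun := by fun_prop
      source' := hbase _ (hs1 0) (hp0' 1)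
      target' := hbase _ (hs1 1) (hp1' 1) }
  have hsq := Path.Homotopic.trans_refl_of_square φ (fun s => hbase _ (hs0 s) (hp0 s))
    (fun t => hbase _ (hF1 t) (hp1' t)) γ δ (fun t => hinj (by
      rw [hφ, hF0, hp0', inv_one, Necklace.Conf.rotate_one])) (fun _ => rfl)
  have hδ : δ.Homotopic (shiftPath n (2 * n * m)) := by
    refine homotopic_shiftPath δ ⟨fun s => n * θ s / Real.pi, by fun_prop⟩ (by simp [hθ0]) ?_ hφ1
    simp only [ContinuousMap.coe_mk, hm]
    have := Real.pi_ne_zero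
    push_cast
    field_simp
  have hmul : FundamentalGroup.fromPath (Path.Homotopic.Quotient.mk δ) *
      FundamentalGroup.fromPath (Path.Homotopic.Quotient.mk γ) = 1 :=
    Path.Homotopic.Quotient.eq.2 hsq
  rw [Path.Homotopic.Quotient.eq.2 hδ, mk_shiftPath] at hmul
  change FundamentalGroup.fromPath (Path.Homotopic.Quotient.mk γ) ∈ _
  rw [eq_inv_of_mul_eq_one_right hmul, Subgroup.inv_mem_iff, zpow_mul]
  exact Subgroup.zpow_mem _ (by exact_mod_cast Subgroup.mem_zpowers _) m

theorem ker_necklaceHom (hn : n ≠ 0) :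
    (necklaceHom n).ker = Subgroup.zpowers (CB.zeta n ^ (2 * n)) := by
  refine le_antisymm (fun a ha => mem_zpowers_of_necklaceHom_eq_one hn ha) ?_
  rw [Subgroup.zpowers_le]
  exact necklaceHom_zeta_pow hn

end CircularBraid

/-- The space of necklaces is path connected: a rotation takes each necklace to one with the standard
core. -/
instance (n : ℕ) : PathConnectedSpace (Necklace.Conf n) := by
  have key : ∀ x : Necklace.Conf n, Joined x (CircularBraid.basePoint n).necklace := by
    intro x
    obtain ⟨q, hq⟩ := exists_rotate_axis x.norm_coreNormal
    obtain ⟨f, hf⟩ := CircularBraid.Conf.exists_necklace_eq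
      (Necklace.Conf.coreNormal_rotate_inv hq)
    have h1 : Joined x f.necklace := by
      have hc : Continuous fun g : UnitQuaternion => Necklace.Conf.rotate g x := by fun_prop
      have h := ((PathConnectedSpace.joined (1 : UnitQuaternion) q⁻¹).map hc)
      rwa [Necklace.Conf.rotate_one, ← hf] at h
    exact h1.trans ((PathConnectedSpace.joined f _).map
      CircularBraid.Conf.isEmbedding_necklace.continuous)
  exact ⟨⟨(CircularBraid.basePoint n).necklace⟩, fun x y => (key x).trans (key y).symm⟩

end

theorem theorem2p2 (n : ℕ) (hn : 2 ≤ n) (x : Necklace.Conf n) :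
    ∃ _ : (Subgroup.zpowers (CB.zeta n ^ (2 * n))).Normal,
      Nonempty (FundamentalGroup (Necklace.Conf n) x ≃*
        CB n ⧸ Subgroup.zpowers (CB.zeta n ^ (2 * n))) := by
  have hn0 : n ≠ 0 := by omega
  have hker := CircularBraid.ker_necklaceHom hn0
  have hnormal : (Subgroup.zpowers (CB.zeta n ^ (2 * n))).Normal := hker ▸ inferInstance
  refine ⟨hnormal, ⟨?_⟩⟩
  exact (FundamentalGroup.fundamentalGroupMulEquivOfPathConnected x
    (CircularBraid.basePoint n).necklace).trans
    ((QuotientGroup.quotientKerEquivOfSurjective _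
      CircularBraid.necklaceHom_surjective).symm.trans (QuotientGroup.quotientMulEquivOfEq hker))
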